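/- Identify $\mathbb N$ with $\{0,1\}^*$ by $0\leftrightarrow\epsilon,\ 1\leftrightarrow 0,\ 2\leftrightarrow 1,\ 3\leftrightarrow 00,\ 4\leftrightarrow 01,\dots$, write $|p|$ for the length of a string $p$, and let $\langle x,y\rangle = 1^{|x|}\,0\,x\,y$ be the standard pairing of binary strings. Let $U$ be a universal Turing machine, that is, for every Turing machine $T$ there is a string $i$ with $U(\langle\langle i,p\rangle,y\rangle)=T(\langle p,y\rangle)$ for all $p,y$, and let $$C(x\mid y)=\min\{|p| : U(\langle p,y\rangle)=x\},\qquad C(x)=C(x\mid\epsilon)$$ be the (conditional) Kolmogorov complexity. A reversible Turing machine is a deterministic multitape Turing machine in which every configuration has at most one predecessor, whose start state is never entered and whose final state is never left; it starts with only its input on its tapes, and its output $R(w)=v$ is defined when it halts in the final state with only $v$ on its tapes. For a reversible Turing machine $R$ let $$E_R(x,y)=\min\{|p|+|q| : R(\langle x,p\rangle)=\langle y,q\rangle\}$$ be its irreversibility cost of computing $y$ from $x$ (with $\min\emptyset=\infty$). Let $UR$ be a reversible Turing machine that is universal for this cost, that is, for every reversible Turing machine $R$ there is a constant $c_R$ with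 $E_{UR}(x,y)\le E_R(x,y)+c_R$ for all $x,y$, and put $E(x,y)=E_{UR}(x,y)$. Then, up to a logarithmic additive term, the irreversibility cost of erasing a record $x$ is its Kolmogorov complexity, $E(x,\epsilon)=C(x)$. Precisely, there is a constant $c$, depending only on $U$ and $UR$, such that for every binary string $x$ the quantities $E(x,\epsilon)$, $C(x)$ and $C(C(x)\mid x)$ are finite and $$C(x)-c\ \le\ E(x,\epsilon)\ \le\ C(x)+2\,C(C(x)\mid x)+c,\qquad C(C(x)\mid x)\le \lfloor\log_2 (C(x)+1)\rfloor+c .$$ -/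

import Mathlib

namespace RevErasure

/-- Binary strings. -/
abbrev Word := List Bool

/-- The standard correspondence between natural numbers and binary strings,
`0 ↦ ε, 1 ↦ 0, 2 ↦ 1, 3 ↦ 00, 4 ↦ 01, …`: the binary expansion of `n + 1`, most significant
bit first, without its leading `1`. -/
def natToWord (n : ℕ) : Word := ((Nat.bits (n + 1)).dropLast).reverse

/-- The standard computable injective pairing `⟨x, y⟩ = 1^{|x|} 0 x y` of binary strings. -/
def pair (x y : Word) : Word := List.replicate x.length true ++ false :: (x ++ y)

/-! ### Kolmogorov complexity -/

/-- `U` is a universal Turing machine (a machine is represented by the partial computable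
function on strings that it computes): for every Turing machine `T` there is an index `i` with
`U ⟨⟨i, p⟩, y⟩ = T ⟨p, y⟩` for all `p, y`, where either both sides are undefined or both are
defined and equal. -/
def IsUniversal (U : Word →. Word) : Prop :=
  Partrec U ∧ ∀ T : Word →. Word, Partrec T →
    ∃ i : Word, ∀ p y : Word, U (pair (pair i p) y) = T (pair p y)

/-- `C(x | y)`: the least length of a program `p` with `U ⟨p, y⟩ = x` (`⊤` if there is none). -/
noncomputable def condComplexity (U : Word →. Word) (x y : Word) : ℕ∞ :=
  ⨅ (p : Word) (_ : x ∈ U (pair p y)), (p.length : ℕ∞)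

/-- `C(x) = C(x | ε)`. -/
noncomputable def complexity (U : Word →. Word) (x : Word) : ℕ∞ := condComplexity U x []

/-! ### Reversible Turing machines -/

/-- A deterministic multitape Turing machine with finitely many states, tapes and tape symbols.
The tape symbols are the blank `none`, the two bits `some (Sum.inl b)`, and auxiliary symbols
`some (Sum.inr a)`. In one step the machine reads the scanned symbol on every tape, and then, on
every tape, writes a symbol and moves the head by at most one cell (`none`: no move). If `δ` is
undefined the machine stops; this always happens in the state `final`. -/
structure TM where
  /-- states -/
  Q : Type
  /-- names of the tapes -/
  ι : Type
  /-- auxiliary tape symbols -/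
  A : Type
  finQ : Finite Q
  finι : Finite ι
  finA : Finite A
  start : Q
  final : Q
  /-- the tape that holds the input and the output -/
  io : ι
  δ : Q → (ι → Option (Bool ⊕ A)) → Option (Q × (ι → Option (Bool ⊕ A) × Option Turing.Dir))
  δ_final : ∀ a, δ final a = none

namespace TM

variable (M : TM)

/-- Instantaneous descriptions. A tape is two-way infinite with finitely many nonblank cells. -/
structure Cfg where
  state : M.Q
  tapes : M.ι → Turing.Tape (Option (Bool ⊕ M.A))

/-- Moving the head of a tape. -/
def moveHead {Γ : Type} [Inhabited Γ] : Option Turing.Dir → Turing.Tape Γ → Turing.Tape Γ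
  | none, T => T
  | some d, T => T.move d

/-- One step of the computation. -/
def step (c : M.Cfg) : Option M.Cfg :=
  (M.δ c.state fun i => (c.tapes i).head).map fun r =>
    ⟨r.1, fun i => moveHead (r.2 i).2 ((c.tapes i).write (r.2 i).1)⟩

open Classical in
/-- The configuration in state `q` in which the input-output tape holds exactly `w`, scanned at
its first symbol, while all the other tapes are blank. -/
noncomputable def wordCfg (q : M.Q) (w : Word) : M.Cfg :=
  ⟨q, fun i => Turing.Tape.mk₁ (if i = M.io then w.map fun b => some (Sum.inl b) else [])⟩

/-- `M(w) = v`: started on `w` with everything else blank, the machine halts in its final state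
with output `v` and everything else blank. -/
def Computes (w v : Word) : Prop :=
  StateTransition.Reaches M.step (M.wordCfg M.start w) (M.wordCfg M.final v)

/-- A reversible Turing machine: every configuration has at most one predecessor, and the
start state is never entered (the mirror image of the convention that the final state is never
left). -/
def IsReversible : Prop :=
  (∀ c c' d : M.Cfg, M.step c = some d → M.step c' = some d → c = c') ∧
    ∀ q a r, M.δ q a = some r → r.1 ≠ M.start

/-- The irreversibility cost `E_M(x, y) = min {|p| + |q| : M ⟨x, p⟩ = ⟨y, q⟩}` (`⊤` if there are
no such `p, q`). -/
noncomputable def irrevCost (x y : Word) : ℕ∞ :=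
  ⨅ (p : Word) (q : Word) (_ : M.Computes (pair x p) (pair y q)),
    ((p.length + q.length : ℕ) : ℕ∞)

/-- `M` is a reversible machine whose irreversibility cost function is universal: it is minimal,
up to an additive constant, among those of all reversible machines. -/
def IsUniversalReversible : Prop :=
  M.IsReversible ∧ ∀ R : TM, R.IsReversible →
    ∃ c : ℕ, ∀ x y : Word, M.irrevCost x y ≤ R.irrevCost x y + c

end TM

end RevErasure

/-! Lower bound. The start state of a reversible machine is never entered and predecessors are
unique, so the output determines the input (`TM.IsReversible.computes_inj`). If `UR` turns `⟨x, p⟩`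
into `⟨ε, q⟩`, then `x` is found from `q` alone by searching for an input and a running time that
lead to `⟨ε, q⟩`. Hence `C(x) ≤ |q| + c`, which is at most the cost plus `c`.

Upper bound. Let `n = C(x)` and `m = C(n | x)`. Choose effectively a program `p = p(x, n)` of length
`n` for `x`, and a program `s = s(x, n, m)` of length `m` that computes `n` from `x`. The
correspondence `⟨x, s⟩ ↔ ⟨ε, 1^m 0 p⟩` is computable in both directions. From left to right, `m =
|s|`, `U` yields `n`, and a search yields `p`. From right to left, `U` yields `x` from `p`, `n =
|p|`, and a search yields `s`. A reversible machine that realises it erases `x` at cost `m + (m + 1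
+ n)`, and `UR` does as well up to a constant (`exists_reversible_erasing`).

The bulk of the proof is Bennett's theorem that an injection computable in both directions is
computed by a reversible machine (`exists_reversible_of_partrec`, `exists_reversible_of_pairs`).
Structured stack programs with syntactic inverses compile to reversible machines
(`exists_reversible_of_prog`). By induction on Kleene's definition, every partial recursive function
has such a program that adds its value to a register and leaves no garbage: compute, copy, uncompute
(`implementable_of_partrec'`). A program for `F` followed by the inverse of a program for `F⁻¹` then
replaces the argument by the value. -/

namespace RevErasure

open Function StateTransition

/-! ### Reversible stack programs -/

/-- A store assigns a stack of bits to every register. -/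
abbrev Store (ι : Type) := ι → List Bool

/-- Tests of the top of a stack (`none`: the stack is empty). -/
abbrev TopTest (ι : Type) := ι × Option Bool

/-- The test succeeds. -/
def TopTest.Holds {ι : Type} (e : TopTest ι) (s : Store ι) : Prop := (s e.1).head? = e.2

/-- Structured reversible programs on stacks. -/
inductive Prog (ι : Type) : Type
  | push (i : ι) (a : Bool) : Prog ι
  | pop (i : ι) (a : Bool) : Prog ι
  | seq (P R : Prog ι) : Prog ι
  /-- Check `e₁`, then repeat `P` until `e₂` holds, checking that `e₁` fails after every round. -/
  | loop (e₁ : TopTest ι) (P : Prog ι) (e₂ : TopTest ι) : Prog ι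

namespace Prog

/-- The inverse program. -/
def inv {ι : Type} : Prog ι → Prog ι
  | push i a => pop i a
  | pop i a => push i a
  | seq P R => seq R.inv P.inv
  | loop e₁ P e₂ => loop e₂ P.inv e₁

/-- `Exec P s s'`: the program `P` transforms the store `s` into `s'`. -/
def Exec {ι : Type} [DecidableEq ι] : Prog ι → Store ι → Store ι → Prop
  | push i a, s, s' => s' = update s i (a :: s i)
  | pop i a, s, s' => s = update s' i (a :: s' i)
  | seq P R, s, s' => ∃ t, P.Exec s t ∧ R.Exec t s'
  | loop e₁ P e₂, s, s' => e₁.Holds s ∧ e₂.Holds s' ∧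
      Relation.ReflTransGen (fun a b => ¬ e₂.Holds a ∧ P.Exec a b ∧ ¬ e₁.Holds b) s s'

variable {ι : Type} [DecidableEq ι]

/-- For a loop, the exit test fails before every round and the entry test fails after every round.
Reading the path backwards exchanges these two conditions. -/
theorem Exec.inv {P : Prog ι} : ∀ {s s' : Store ι}, P.Exec s s' → P.inv.Exec s' s := by
  induction P with
  | push i a => exact fun h => h
  | pop i a => exact fun h => h
  | seq P R ihP ihR => exact fun ⟨t, h1, h2⟩ => ⟨t, ihR h2, ihP h1⟩
  | loop e₁ P e₂ ih =>
    rintro s s' ⟨h1, h2, h3⟩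
    refine ⟨h2, h1, ?_⟩
    exact h3.swap.lift id fun a b ⟨h4, h5, h6⟩ => ⟨h6, ih h5, h4⟩

theorem Exec.seq {P R : Prog ι} {s t s' : Store ι} (h1 : P.Exec s t) (h2 : R.Exec t s') :
    (P.seq R).Exec s s' := ⟨t, h1, h2⟩

/-- Running `P`, then `R`, then undoing `P`. -/
theorem Exec.conj {P R : Prog ι} {s t s' t' : Store ι} (h1 : P.Exec s t) (h2 : R.Exec t t')
    (h3 : P.Exec s' t') : (P.seq (R.seq P.inv)).Exec s s' :=
  h1.seq (h2.seq h3.inv)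

/-- The tool for verifying loops: `σ j` is the store after `j` rounds. -/
theorem exec_loop {e₁ e₂ : TopTest ι} {P : Prog ι} (σ : ℕ → Store ι) (k : ℕ)
    (h1 : e₁.Holds (σ 0)) (h1' : ∀ j < k, ¬ e₁.Holds (σ (j + 1))) (h2 : e₂.Holds (σ k))
    (h2' : ∀ j < k, ¬ e₂.Holds (σ j)) (hP : ∀ j < k, P.Exec (σ j) (σ (j + 1))) :
    (loop e₁ P e₂).Exec (σ 0) (σ k) := by
  refine ⟨h1, h2, ?_⟩
  have : ∀ j ≤ k, Relation.ReflTransGen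
      (fun a b => ¬ e₂.Holds a ∧ P.Exec a b ∧ ¬ e₁.Holds b) (σ 0) (σ j) := by
    intro j
    induction j with
    | zero => exact fun _ => .refl
    | succ j ih => exact fun hj => (ih (by omega)).tail ⟨h2' j hj, hP j hj, h1' j hj⟩
  exact this k le_rfl

/-! ### Renaming registers -/

/-- Renaming the registers of a program. -/
def map {κ : Type} (f : ι → κ) : Prog ι → Prog κ
  | push i a => push (f i) a
  | pop i a => pop (f i) a
  | seq P R => seq (P.map f) (R.map f)
  | loop e₁ P e₂ => loop (f e₁.1, e₁.2) (P.map f) (f e₂.1, e₂.2)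

/-- A strict upper bound of the registers of a program. -/
def bound : Prog ℕ → ℕ
  | push i _ => i + 1
  | pop i _ => i + 1
  | seq P R => max P.bound R.bound
  | loop e₁ P e₂ => max (max (e₁.1 + 1) (e₂.1 + 1)) P.bound

theorem update_comp_val {K : ℕ} (s : Store ℕ) (i : Fin K) (l : List Bool) :
    (update s i.1 l) ∘ Fin.val = update (s ∘ Fin.val) i l :=
  update_comp_eq_of_injective _ Fin.val_injective _ _

/-- Registers indexed by `ℕ` give an endless supply of fresh ones, but a machine has finitely many
tapes. Below `bound` the reduction modulo `K` changes nothing. -/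
theorem Exec.map {K : ℕ} [NeZero K] {P : Prog ℕ} : ∀ {s s' : Store ℕ}, P.bound ≤ K →
    P.Exec s s' → (P.map (Fin.ofNat K)).Exec (s ∘ Fin.val) (s' ∘ Fin.val) := by
  have key : ∀ i < K, ∃ j : Fin K, j.1 = i ∧ Fin.ofNat K i = j := fun i hi =>
    ⟨⟨i, hi⟩, rfl, Fin.ext (by simp [Nat.mod_eq_of_lt hi])⟩
  induction P with
  | push i a =>
    rintro s s' hb h
    obtain ⟨j, rfl, hj⟩ := key i hb
    simp only [Prog.map, Exec, hj] at h ⊢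
    rw [h, update_comp_val]; rfl
  | pop i a =>
    rintro s s' hb h
    obtain ⟨j, rfl, hj⟩ := key i hb
    simp only [Prog.map, Exec, hj] at h ⊢
    rw [h, update_comp_val]; rfl
  | seq P R ihP ihR =>
    rintro s s' hb ⟨t, h1, h2⟩
    exact ⟨_, ihP ((le_max_left _ _).trans hb) h1, ihR ((le_max_right _ _).trans hb) h2⟩
  | loop e₁ P e₂ ih =>
    rintro s s' hb ⟨h1, h2, h3⟩
    simp only [bound, max_le_iff] at hb
    have k1 : ∀ s : Store ℕ,
        TopTest.Holds (Fin.ofNat K e₁.1, e₁.2) (s ∘ Fin.val) ↔ e₁.Holds s := fun s => by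
      simp [TopTest.Holds, Nat.mod_eq_of_lt hb.1.1]
    have k2 : ∀ s : Store ℕ,
        TopTest.Holds (Fin.ofNat K e₂.1, e₂.2) (s ∘ Fin.val) ↔ e₂.Holds s := fun s => by
      simp [TopTest.Holds, Nat.mod_eq_of_lt hb.1.2]
    refine ⟨(k1 _).2 h1, (k2 _).2 h2, ?_⟩
    refine h3.lift (fun s : Store ℕ => s ∘ Fin.val) fun a b ⟨h4, h5, h6⟩ => ?_
    exact ⟨(k2 _).not.2 h4, ih hb.2 h5, (k1 _).not.2 h6⟩

end Prog

/-! ### Realisation by multitape machines -/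

/-- Tape symbols: blanks and bits. -/
abbrev Sym := Option (Bool ⊕ Empty)

/-- The action of a transition on the tapes. -/
def act {ι : Type} (r : ι → Sym × Option Turing.Dir) (T : ι → Turing.Tape Sym) :
    ι → Turing.Tape Sym :=
  fun i => TM.moveHead (r i).2 ((T i).write (r i).1)

theorem act_nop {ι : Type} (T : ι → Turing.Tape Sym) :
    act (fun i => ((T i).head, none)) T = T := by
  funext i
  exact Turing.Tape.write_self _

/-- A control unit with states `Q` for tapes indexed by `ι`. -/
structure Control (ι Q : Type) where
  start : Q
  final : Q
  /-- transition function -/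
  δ : Q → (ι → Sym) → Option (Q × (ι → Sym × Option Turing.Dir))

namespace Control

variable {ι Q Q' : Type}

/-- One step. -/
def step (M : Control ι Q) (c : Q × (ι → Turing.Tape Sym)) :
    Option (Q × (ι → Turing.Tape Sym)) :=
  (M.δ c.1 fun i => (c.2 i).head).map fun r => (r.1, act r.2 c.2)

/-- Reversibility of a control unit. -/
structure Rev (M : Control ι Q) : Prop where
  final : ∀ a, M.δ M.final a = none
  start : ∀ q a r, M.δ q a = some r → r.1 ≠ M.start
  inj : ∀ c c' d, M.step c = some d → M.step c' = some d → c = c'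

theorem Rev.step_final {M : Control ι Q} (h : M.Rev) (T) : M.step (M.final, T) = none := by
  simp [step, h.final]

theorem Rev.step_start {M : Control ι Q} (h : M.Rev) {c d} (h' : M.step c = some d) :
    d.1 ≠ M.start := by
  simp only [step, Option.map_eq_some_iff] at h'
  obtain ⟨r, hr, rfl⟩ := h'
  exact h.start _ _ _ hr

/-- The machine passes from the start state to the final state, changing the tapes as said. -/
def Runs (M : Control ι Q) (T T' : ι → Turing.Tape Sym) : Prop :=
  Reaches M.step (M.start, T) (M.final, T')

/-- The tapes that hold given stacks. -/
def stackTapes (s : Store ι) : ι → Turing.Tape Sym :=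
  fun i => Turing.Tape.mk₁ ((s i).map fun b => some (Sum.inl b))

theorem head_stackTapes (s : Store ι) (i : ι) :
    (stackTapes s i).head = (s i).head?.map Sum.inl := by
  cases h : s i <;> simp [stackTapes, h, Turing.Tape.mk₁, Turing.Tape.mk₂]
  rfl

/-- Pushing a bit: the head moves to the left and then writes. -/
def push [DecidableEq ι] (i : ι) (a : Bool) : Control ι (Fin 3) where
  start := 0
  final := 2
  δ q h := if q = 0 then some (1, fun j => (h j, if j = i then some .left else none)) else
    -- Only a blank may be overwritten, so the old symbol is known and the step is injective.
    if q = 1 ∧ h i = none then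
      some (2, fun j => (if j = i then some (.inl a) else h j, none)) else none

/-- Popping a bit: the head erases and then moves to the right. -/
def pop [DecidableEq ι] (i : ι) (a : Bool) : Control ι Bool where
  start := false
  final := true
  -- Only the expected bit is erased, so no information is lost.
  δ q h := if q = false ∧ h i = some (.inl a) then
    some (true, fun j => if j = i then (none, some .right) else (h j, none)) else none

/-- Running one control unit after another. -/
noncomputable def seq (M : Control ι Q) (N : Control ι Q') : Control ι (Q ⊕ Q') where
  start := .inl M.start
  final := .inr N.final
  δ := open Classical in fun q h => match q with
    | .inl q => if q = M.final then some (.inr N.start, fun i => (h i, none))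
        else (M.δ q h).map fun r => (.inl r.1, r.2)
    | .inr q => (N.δ q h).map fun r => (.inr r.1, r.2)

/-- A test of the scanned symbols. -/
def testHeads (e : TopTest ι) (h : ι → Sym) : Prop := h e.1 = e.2.map Sum.inl

/-- Iterating a control unit. -/
noncomputable def loop (e₁ : TopTest ι) (M : Control ι Q) (e₂ : TopTest ι) : Control ι (Q ⊕ Option Bool) where
  start := .inr none
  final := .inr (some true)
  -- `none` is the entrance, `some true` the exit, and `some false` the junction, visited before the
  -- first round and after each round.
  δ := open Classical in fun q h => match q with
    | .inl q => if q = M.final then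
          if testHeads e₁ h then none else some (.inr (some false), fun i => (h i, none))
        else (M.δ q h).map fun r => (.inl r.1, r.2)
    | .inr none => if testHeads e₁ h then some (.inr (some false), fun i => (h i, none)) else none
    | .inr (some false) => some (if testHeads e₂ h then .inr (some true) else .inl M.start, fun i => (h i, none))
    | .inr (some true) => none

end Control

theorem tape_eq_of_write_eq {T T' : Turing.Tape Sym} {b : Sym} (h : T.head = T'.head)
    (h' : T.write b = T'.write b) : T = T' := by
  cases T; cases T'
  simp_all [Turing.Tape.write]

/-! ### Reversibility and correctness of the control units -/

namespace Control

variable {ι Q Q' : Type}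

theorem push_rev [DecidableEq ι] (i : ι) (a : Bool) : (push i a).Rev where
  final h := by simp [push]
  start q h r hr := by
    simp only [push] at hr ⊢
    split_ifs at hr <;> simp only [Option.some.injEq] at hr <;> subst hr <;> simp
  inj := by
    rintro ⟨q, T⟩ ⟨q', T'⟩ d hd hd'
    simp only [step, push, Option.map_eq_some_iff] at hd hd'
    obtain ⟨r, hr, rfl⟩ := hd
    obtain ⟨r', hr', he⟩ := hd'
    split_ifs at hr hr' with h1 h2 _ h3 _ h5 <;> simp only [Option.some.injEq] at hr hr' <;>
      subst hr hr' <;> simp only [Prod.mk.injEq] at he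
    · refine Prod.ext (by simp [h1, h2]) (funext fun j => ?_)
      have := congrFun he.2 j
      by_cases hj : j = i
      · simp only [act, hj, if_true, TM.moveHead, Turing.Tape.write_self] at this ⊢
        simpa using (congrArg (Turing.Tape.move .right) this).symm
      · simpa [act, hj, TM.moveHead, Turing.Tape.write_self] using this.symm
    · simp at he
    · simp at he
    · refine Prod.ext (by simp [h3.1, h5.1]) (funext fun j => ?_)
      have := congrFun he.2 j
      by_cases hj : j = i
      · subst hj
        simp only [act, if_true, TM.moveHead] at this
        exact tape_eq_of_write_eq (h3.2.trans h5.2.symm) this.symm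
      · simpa [act, hj, TM.moveHead, Turing.Tape.write_self] using this.symm

theorem pop_rev [DecidableEq ι] (i : ι) (a : Bool) : (pop i a).Rev where
  final h := by simp [pop]
  start q h r hr := by
    simp only [pop] at hr ⊢
    split_ifs at hr; simp only [Option.some.injEq] at hr; subst hr; simp
  inj := by
    rintro ⟨q, T⟩ ⟨q', T'⟩ d hd hd'
    simp only [step, pop, Option.map_eq_some_iff] at hd hd'
    obtain ⟨r, hr, rfl⟩ := hd
    obtain ⟨r', hr', he⟩ := hd'
    split_ifs at hr hr' with h1 h2
    simp only [Option.some.injEq] at hr hr'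
    subst hr hr'
    simp only [Prod.mk.injEq, true_and] at he
    refine Prod.ext (by simp [h1, h2]) (funext fun j => ?_)
    have := congrFun he j
    by_cases hj : j = i
    · subst hj
      simp only [act, if_true, TM.moveHead] at this
      refine tape_eq_of_write_eq (h1.2.trans h2.2.symm) ?_ (b := none)
      simpa using (congrArg (Turing.Tape.move .left) this).symm
    · simpa [act, hj, TM.moveHead, Turing.Tape.write_self] using this.symm

theorem push_runs [DecidableEq ι] (i : ι) (a : Bool) (s : Store ι) :
    (push i a).Runs (stackTapes s) (stackTapes (update s i (a :: s i))) := by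
  have h : (1,  fun j => if j = i then (stackTapes s j).move .left else stackTapes s j) ∈
      (push i a).step ((push i a).start, stackTapes s) := by
    simp only [step, push, Option.mem_def, if_true, Option.map_some, Option.some.injEq,
      Prod.mk.injEq, true_and]
    funext j
    by_cases hj : j = i <;> simp [act, hj, TM.moveHead, Turing.Tape.write_self]
  refine Relation.ReflTransGen.head h (Relation.ReflTransGen.single ?_)
  · simp only [step, push, Option.mem_def, if_true]
    rw [if_neg (by decide), if_pos]
    · simp only [Option.map_some, Option.some.injEq, Prod.mk.injEq, true_and]
      funext j
      by_cases hj : j = i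
      · subst hj
        simp [act, TM.moveHead, stackTapes, Turing.Tape.mk₁, Turing.Tape.mk₂]
      · simp [act, hj, TM.moveHead, Turing.Tape.write_self, stackTapes]
    · simp [stackTapes, Turing.Tape.mk₁, Turing.Tape.mk₂]
      rfl

theorem pop_runs [DecidableEq ι] (i : ι) (a : Bool) (s : Store ι) :
    (pop i a).Runs (stackTapes (update s i (a :: s i))) (stackTapes s) := by
  refine Relation.ReflTransGen.single ?_
  simp only [step, pop, Option.mem_def, true_and]
  rw [if_pos]
  · simp only [Option.map_some, Option.some.injEq, Prod.mk.injEq, true_and]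
    funext j
    by_cases hj : j = i
    · subst hj
      simp only [act, if_true, TM.moveHead, stackTapes, Turing.Tape.mk₁, Turing.Tape.mk₂,
        update_self, Turing.Tape.write_mk', Turing.Tape.move_right_mk']
      simp only [List.map_cons, ← Turing.ListBlank.cons_mk, Turing.ListBlank.tail_cons,
        Turing.ListBlank.head_cons]
      congr 1
      -- The erased cell makes the left half of the tape `[none]`, which is the blank half-tape.
      exact Quotient.sound' (Or.inr ⟨1, rfl⟩)
    · simp [act, hj, TM.moveHead, Turing.Tape.write_self, stackTapes]
  · simp [head_stackTapes]

/-- Agreement is needed only off `M.final`: this state has no successor in `M`, so no step of the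
run starts there, and the larger machine may continue from it. -/
theorem reaches_embed {M : Control ι Q} {N : Control ι Q'} (hM : M.Rev) (f : Q → Q')
    (h : ∀ q T, q ≠ M.final → N.step (f q, T) = (M.step (q, T)).map fun c => (f c.1, c.2))
    {T T' : ι → Turing.Tape Sym} (h1 : M.Runs T T') :
    Reaches N.step (f M.start, T) (f M.final, T') := by
  refine h1.lift (fun c => (f c.1, c.2)) fun a b hab => ?_
  have : a.1 ≠ M.final := by
    rintro h
    have := hM.step_final a.2
    rw [← h] at this
    simp_all
  rw [Option.mem_def] at hab
  simp [Function.onFun, h _ _ this, hab]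

theorem seq_step_inl (M : Control ι Q) (N : Control ι Q') (q : Q) (T : ι → Turing.Tape Sym) :
    (seq M N).step (.inl q, T) = open Classical in if q = M.final then some (.inr N.start, T)
      else (M.step (q, T)).map fun c => (.inl c.1, c.2) := by
  classical
  simp only [step, seq]
  split_ifs with h
  · simp [act_nop]
  · simp [Option.map_map, comp_def]

theorem seq_step_inr (M : Control ι Q) (N : Control ι Q') (q : Q') (T : ι → Turing.Tape Sym) :
    (seq M N).step (.inr q, T) = (N.step (q, T)).map fun c => (.inr c.1, c.2) := by
  simp [step, seq, Option.map_map, comp_def]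

/-- The only new transition leads from `M.final` to `N.start`. It shares its target with no other,
since `N` never enters its start state. -/
theorem seq_rev {M : Control ι Q} {N : Control ι Q'} (hM : M.Rev) (hN : N.Rev) : (seq M N).Rev where
  final h := by simp [seq, hN.final]
  start q h r hr := by
    rcases q with q | q
    · simp only [seq] at hr ⊢
      split_ifs at hr
      · simp only [Option.some.injEq] at hr; subst hr; simp
      · obtain ⟨r', hr', rfl⟩ := Option.map_eq_some_iff.1 hr
        simpa using hM.start _ _ _ hr'
    · obtain ⟨r', hr', rfl⟩ := Option.map_eq_some_iff.1 hr
      simp [seq]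
  inj := by
    rintro ⟨q | q, T⟩ ⟨q' | q', T'⟩ d hd hd' <;>
      simp only [seq_step_inl, seq_step_inr] at hd hd'
    · split_ifs at hd hd' with h1 h2 h2
      · subst h1 h2
        have := hd.trans hd'.symm
        simp only [Option.some.injEq, Prod.mk.injEq, true_and] at this
        rw [this]
      · obtain ⟨r', hr', rfl⟩ := Option.map_eq_some_iff.1 hd'
        simp at hd
      · obtain ⟨r', hr', rfl⟩ := Option.map_eq_some_iff.1 hd
        simp at hd'
      · obtain ⟨r, hr, rfl⟩ := Option.map_eq_some_iff.1 hd
        obtain ⟨r', hr', he⟩ := Option.map_eq_some_iff.1 hd'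
        simp only [Prod.mk.injEq, Sum.inl.injEq] at he
        obtain rfl : r' = r := Prod.ext he.1 he.2
        simpa using hM.inj _ _ _ hr hr'
    · obtain ⟨r', hr', rfl⟩ := Option.map_eq_some_iff.1 hd'
      split_ifs at hd
      · simp only [Option.some.injEq, Prod.mk.injEq, Sum.inr.injEq] at hd
        exact absurd hd.1.symm (hN.step_start hr')
      · obtain ⟨r, hr, he⟩ := Option.map_eq_some_iff.1 hd
        simp at he
    · obtain ⟨r', hr', rfl⟩ := Option.map_eq_some_iff.1 hd
      split_ifs at hd'
      · simp only [Option.some.injEq, Prod.mk.injEq, Sum.inr.injEq] at hd'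
        exact absurd hd'.1.symm (hN.step_start hr')
      · obtain ⟨r, hr, he⟩ := Option.map_eq_some_iff.1 hd'
        simp at he
    · obtain ⟨r, hr, rfl⟩ := Option.map_eq_some_iff.1 hd
      obtain ⟨r', hr', he⟩ := Option.map_eq_some_iff.1 hd'
      simp only [Prod.mk.injEq, Sum.inr.injEq] at he
      obtain rfl : r' = r := Prod.ext he.1 he.2
      simpa using hN.inj _ _ _ hr hr'

theorem seq_runs {M : Control ι Q} {N : Control ι Q'} (hM : M.Rev) (hN : N.Rev)
    {T T' T'' : ι → Turing.Tape Sym} (h1 : M.Runs T T') (h2 : N.Runs T' T'') :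
    (seq M N).Runs T T'' := by
  have k1 := reaches_embed (N := seq M N) hM Sum.inl (fun q T hq => by
    simp [seq_step_inl, hq]) h1
  have k2 := reaches_embed (N := seq M N) hN Sum.inr (fun q T _ => seq_step_inr M N q T) h2
  exact (k1.tail (by simp [seq_step_inl])).trans k2

theorem loop_step_inl (e₁ e₂ : TopTest ι) (M : Control ι Q) (q : Q) (T : ι → Turing.Tape Sym) :
    (loop e₁ M e₂).step (.inl q, T) = open Classical in if q = M.final then
      if testHeads e₁ (fun i => (T i).head) then none else some (.inr (some false), T)
      else (M.step (q, T)).map fun c => (.inl c.1, c.2) := by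
  classical
  simp only [step, loop]
  split_ifs with h
  · simp
  · simp [act_nop]
  · simp [Option.map_map, comp_def]

theorem loop_step_zero (e₁ e₂ : TopTest ι) (M : Control ι Q) (T : ι → Turing.Tape Sym) :
    (loop e₁ M e₂).step (.inr none, T) = open Classical in
      if testHeads e₁ (fun i => (T i).head) then some (.inr (some false), T) else none := by
  classical
  simp only [step, loop]
  split_ifs with h <;> simp [act_nop]

theorem loop_step_one (e₁ e₂ : TopTest ι) (M : Control ι Q) (T : ι → Turing.Tape Sym) :
    (loop e₁ M e₂).step (.inr (some false), T) = open Classical in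
      some (if testHeads e₂ (fun i => (T i).head) then .inr (some true) else .inl M.start, T) := by
  classical
  simp [step, loop, act_nop]

theorem loop_step_two (e₁ e₂ : TopTest ι) (M : Control ι Q) (T : ι → Turing.Tape Sym) :
    (loop e₁ M e₂).step (.inr (some true), T) = none := by
  simp [step, loop]

theorem loop_step_cases {e₁ e₂ : TopTest ι} {M : Control ι Q}
    {c d : (Q ⊕ Option Bool) × (ι → Turing.Tape Sym)} (h : (loop e₁ M e₂).step c = some d) :
    (∃ b b', M.step b = some b' ∧ c = (.inl b.1, b.2) ∧ d = (.inl b'.1, b'.2)) ∨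
    (∃ T, ¬ testHeads e₁ (fun i => (T i).head) ∧ c = (.inl M.final, T) ∧ d = (.inr (some false), T)) ∨
    (∃ T, testHeads e₁ (fun i => (T i).head) ∧ c = (.inr none, T) ∧ d = (.inr (some false), T)) ∨
    ∃ T, c = (.inr (some false), T) ∧ (d = (.inr (some true), T) ∨ d = (.inl M.start, T)) := by
  obtain ⟨q | q, T⟩ := c
  · rw [loop_step_inl] at h
    split_ifs at h with h1 h2
    · simp_all
    · obtain ⟨b', hb', rfl⟩ := Option.map_eq_some_iff.1 h
      exact .inl ⟨(q, T), b', hb', rfl, rfl⟩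
  · obtain _ | _ | _ := q
    · rw [loop_step_zero] at h
      split_ifs at h
      simp_all
    · rw [loop_step_one] at h
      split_ifs at h <;> simp_all
    · simp [loop_step_two] at h

/-- The new transitions leave the tapes unchanged. The junction is entered from the entrance if `e₁`
holds and from `M.final` if `e₁` fails, so the tapes tell which; `M.start` is entered only from the
junction. -/
theorem loop_rev {M : Control ι Q} (hM : M.Rev) (e₁ e₂ : TopTest ι) : (loop e₁ M e₂).Rev where
  final h := by simp [loop]
  start q h r hr := by
    classical
    obtain q | q := q
    · simp only [loop] at hr ⊢
      split_ifs at hr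
      · simp only [Option.some.injEq] at hr; subst hr; simp
      · obtain ⟨r', hr', rfl⟩ := Option.map_eq_some_iff.1 hr
        simp
    · obtain _ | _ | _ := q
      · simp only [loop] at hr ⊢
        split_ifs at hr
        simp only [Option.some.injEq] at hr; subst hr; simp
      · simp only [loop, Option.some.injEq] at hr ⊢
        subst hr
        split_ifs <;> simp
      · simp [loop] at hr
  inj c c' d h h' := by
    obtain ⟨b, b', hb, rfl, rfl⟩ | ⟨T, hT, rfl, rfl⟩ | ⟨T, hT, rfl, rfl⟩ | ⟨T, rfl, rfl | rfl⟩ :=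
      loop_step_cases h <;>
    obtain ⟨b₁, b₁', hb₁, rfl, h₁⟩ | ⟨T₁, hT₁, rfl, h₁⟩ | ⟨T₁, hT₁, rfl, h₁⟩ |
      ⟨T₁, rfl, h₁ | h₁⟩ := loop_step_cases h' <;>
    simp only [Prod.mk.injEq, Sum.inl.injEq, Sum.inr.injEq, Option.some.injEq, reduceCtorEq,
      false_and, true_and] at h₁ ⊢
    · obtain rfl : b' = b₁' := Prod.ext h₁.1 h₁.2
      obtain rfl := hM.inj _ _ _ hb hb₁
      simp
    · exact absurd h₁.1 (hM.step_start hb)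
    · exact h₁
    · exact absurd hT₁ (h₁ ▸ hT)
    · exact absurd hT (h₁ ▸ hT₁)
    · exact h₁
    · exact h₁
    · exact absurd h₁.1.symm (hM.step_start hb₁)
    · exact h₁

theorem testHeads_stackTapes (e : TopTest ι) (s : Store ι) :
    testHeads e (fun i => (stackTapes s i).head) ↔ e.Holds s := by
  simp only [testHeads, head_stackTapes, TopTest.Holds]
  exact (Option.map_injective Sum.inl_injective).eq_iff

theorem loop_runs {M : Control ι Q} (hM : M.Rev) {e₁ e₂ : TopTest ι} {R : Store ι → Store ι → Prop}
    (hR : ∀ s s', R s s' → M.Runs (stackTapes s) (stackTapes s')) {s s' : Store ι}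
    (h1 : e₁.Holds s) (h2 : e₂.Holds s')
    (h : Relation.ReflTransGen (fun a b => ¬ e₂.Holds a ∧ R a b ∧ ¬ e₁.Holds b) s s') :
    (loop e₁ M e₂).Runs (stackTapes s) (stackTapes s') := by
  have k : Reaches (loop e₁ M e₂).step (.inr (some false), stackTapes s) (.inr (some false), stackTapes s') := by
    -- The exit test holds at the last store only, so it cannot be part of the induction.
    clear h2
    induction h with
    | refl => exact .refl
    | tail _ hbc ih =>
      obtain ⟨h3, h4, h5⟩ := hbc
      refine ih.trans ?_
      refine Relation.ReflTransGen.head (b := (.inl M.start, _)) ?_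
        ((reaches_embed hM Sum.inl (fun q T hq => ?_) (hR _ _ h4)).tail ?_)
      · simp [loop_step_one, testHeads_stackTapes, h3]
      · simp [loop_step_inl, hq]
      · simp [loop_step_inl, testHeads_stackTapes, h5]
  refine Relation.ReflTransGen.head (b := (.inr (some false), _)) ?_ (k.tail ?_)
  · rw [show (loop e₁ M e₂).start = .inr none from rfl]
    simp [loop_step_zero, testHeads_stackTapes, h1]
  · simp [loop_step_one, testHeads_stackTapes, h2]; rfl

theorem exists_of_prog [DecidableEq ι] (P : Prog ι) : ∃ (Q : Type) (_ : Finite Q)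
    (M : Control ι Q), M.Rev ∧
      ∀ s s' : Store ι, P.Exec s s' → M.Runs (stackTapes s) (stackTapes s') := by
  induction P with
  | push i a =>
    refine ⟨_, inferInstance, push i a, push_rev i a, ?_⟩
    rintro s s' rfl
    exact push_runs i a s
  | pop i a =>
    refine ⟨_, inferInstance, pop i a, pop_rev i a, ?_⟩
    rintro s s' h
    simp only [Prog.Exec] at h
    rw [h]
    exact pop_runs i a s'
  | seq P R ihP ihR =>
    obtain ⟨Q, _, M, hM, h⟩ := ihP
    obtain ⟨Q', _, N, hN, h'⟩ := ihR
    refine ⟨_, inferInstance, seq M N, seq_rev hM hN, ?_⟩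
    rintro s s' ⟨t, h1, h2⟩
    exact seq_runs hM hN (h _ _ h1) (h' _ _ h2)
  | loop e₁ P e₂ ih =>
    obtain ⟨Q, _, M, hM, h⟩ := ih
    refine ⟨_, inferInstance, loop e₁ M e₂, loop_rev hM e₁ e₂, ?_⟩
    rintro s s' ⟨h1, h2, h3⟩
    exact loop_runs hM h h1 h2 h3

end Control

/-- The store that holds `w` in register `i` and nothing else. -/
def wordStore {ι : Type} [DecidableEq ι] (i : ι) (w : Word) : Store ι := update (fun _ => []) i w

/-- A program for the transformation of words is realised by a reversible Turing machine. -/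
theorem exists_reversible_of_prog (P : Prog ℕ) : ∃ R : TM, R.IsReversible ∧
    ∀ w v, P.Exec (wordStore 0 w) (wordStore 0 v) → R.Computes w v := by
  obtain ⟨Q, hQ, M, hM, h⟩ := Control.exists_of_prog (P.map (Fin.ofNat (P.bound + 1)))
  let R : TM :=
    { Q := Q, ι := Fin (P.bound + 1), A := Empty, finQ := hQ, finι := inferInstance,
      finA := inferInstance, start := M.start, final := M.final, io := 0, δ := M.δ,
      δ_final := hM.final }
  have hstep : ∀ c : R.Cfg,
      R.step c = (M.step (c.state, c.tapes)).map fun d => ⟨d.1, d.2⟩ := fun c => by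
    simp only [TM.step, Control.step, Option.map_map]
    rfl
  refine ⟨R, ⟨fun c c' d hc hc' => ?_, hM.start⟩, fun w v hwv => ?_⟩
  · rw [hstep] at hc hc'
    obtain ⟨b, hb, rfl⟩ := Option.map_eq_some_iff.1 hc
    obtain ⟨b', hb', he⟩ := Option.map_eq_some_iff.1 hc'
    simp only [TM.Cfg.mk.injEq] at he
    obtain rfl : b' = b := Prod.ext he.1 he.2
    have := hM.inj _ _ _ hb hb'
    cases c; cases c'; simpa using this
  · have h1 := h _ _ (Prog.Exec.map (K := P.bound + 1) (by omega) hwv)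
    have key : ∀ (q : Q) (w : Word), R.wordCfg q w =
        ⟨q, Control.stackTapes (wordStore (ι := ℕ) 0 w ∘ Fin.val)⟩ := by
      intro q w
      simp only [TM.wordCfg, TM.Cfg.mk.injEq, true_and]
      funext i
      simp only [Control.stackTapes, wordStore, comp, update_apply]
      by_cases hi : i = R.io
      · simp [hi, R]
      · have : i.1 ≠ 0 := fun h => hi (Fin.ext h)
        simp [hi, this]
    unfold TM.Computes
    rw [key, key]
    refine Relation.ReflTransGen.lift (p := fun a b => b ∈ R.step a)
      (fun c => (⟨c.1, c.2⟩ : R.Cfg)) (fun a b hab => ?_) _ _ h1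
    rw [Option.mem_def] at hab
    simp [onFun, hstep, hab]

/-! ### Numerical programs -/

/-- The unary representation of a number. -/
abbrev num (n : ℕ) : List Bool := List.replicate n true

theorem num_pos {n : ℕ} (h : 0 < n) : num n = true :: num (n - 1) := by
  obtain ⟨m, rfl⟩ := Nat.exists_eq_add_of_lt h
  simp [num, List.replicate_succ]

theorem num_succ (n : ℕ) : num (n + 1) = true :: num n := rfl

theorem head?_num_eq_none {n : ℕ} : (num n).head? = none ↔ n = 0 := by
  cases n <;> simp [num, List.replicate_succ]

namespace Prog

theorem exec_push {i : ℕ} {a : Bool} {s s' : Store ℕ} (h : s' = update s i (a :: s i)) :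
    (push i a).Exec s s' := h

theorem exec_pop {i : ℕ} {a : Bool} {s s' : Store ℕ} {l : List Bool} (h : s i = a :: l)
    (h' : s' = update s i l) : (pop i a).Exec s s' := by
  subst h'
  simp [Exec, ← h]

theorem Exec.of_eq {P : Prog ℕ} {s t t' : Store ℕ} (h : P.Exec s t) (e : t = t') : P.Exec s t' :=
  e ▸ h

theorem Exec.of_eq_left {P : Prog ℕ} {s s' t : Store ℕ} (h : P.Exec s t) (e : s = s') :
    P.Exec s' t := e ▸ h

/-- Moving the number in register `x` to the empty register `t`. -/
def move (x t : ℕ) : Prog ℕ := loop (t, none) (seq (pop x true) (push t true)) (x, none)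

theorem exec_move {x t n : ℕ} (hxt : x ≠ t) {s : Store ℕ} (hx : s x = num n) (ht : s t = []) :
    (move x t).Exec s (update (update s x []) t (num n)) := by
  have := exec_loop (e₁ := (t, none)) (e₂ := (x, none)) (P := seq (pop x true) (push t true))
    (fun j => update (update s x (num (n - j))) t (num j)) n (by simp [TopTest.Holds])
    (by simp [TopTest.Holds]) (by simp [TopTest.Holds, hxt])
    (fun j hj => by simp [TopTest.Holds, hxt]; omega)
    (fun j hj => by
      refine (exec_pop (l := num (n - (j + 1))) ?_ rfl).seq (exec_push ?_)
      · simp [hxt, num_pos (Nat.sub_pos_of_lt hj), Nat.sub_sub]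
      · funext r
        simp only [update_apply]
        split_ifs <;> simp_all [num_succ])
  refine (this.of_eq_left ?_).of_eq ?_
  · funext r
    simp only [update_apply]
    split_ifs <;> simp_all
  · simp

/-- Adding the number in register `x` to register `o`, with the empty register `t` for help. -/
def copy (x o t : ℕ) : Prog ℕ :=
  seq (loop (t, none) (seq (pop x true) (seq (push t true) (push o true))) (x, none)) (move t x)

theorem exec_copy {x o t n : ℕ} (hxt : x ≠ t) (hxo : x ≠ o) (hot : o ≠ t) {s : Store ℕ}
    (hx : s x = num n) (ht : s t = []) :
    (copy x o t).Exec s (update s o (num n ++ s o)) := by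
  have := exec_loop (e₁ := (t, none)) (e₂ := (x, none))
    (P := seq (pop x true) (seq (push t true) (push o true)))
    (fun j => update (update (update s x (num (n - j))) t (num j)) o (num j ++ s o)) n
    (by simp [TopTest.Holds, hot.symm])
    (by simp [TopTest.Holds, hot.symm]) (by simp [TopTest.Holds, hxt, hxo])
    (fun j hj => by simp [TopTest.Holds, hxt, hxo]; omega)
    (fun j hj => by
      refine (exec_pop (l := num (n - (j + 1))) ?_ rfl).seq
        ((exec_push rfl).seq (exec_push ?_))
      · simp [hxt, hxo, num_pos (Nat.sub_pos_of_lt hj), Nat.sub_sub]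
      · funext r
        simp only [update_apply]
        split_ifs <;> simp_all [num_succ])
  refine Exec.seq (this.of_eq_left ?_) ((exec_move (n := n) hxt.symm ?_ ?_).of_eq ?_)
  · funext r
    simp only [update_apply]
    split_ifs <;> simp_all
  · simp [hot.symm]
  · simp [hxt, hxo]
  · funext r
    simp only [update_apply]
    split_ifs <;> simp_all

/-- The program `P` adds `f v` to register `o`, where `v` is found in the registers `xs` and the
registers from `b` on are empty. -/
def Implements {n : ℕ} (f : List.Vector ℕ n →. ℕ) (xs : Fin n → ℕ) (o b : ℕ) (P : Prog ℕ) : Prop :=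
  ∀ (s : Store ℕ) (v : List.Vector ℕ n) (y : ℕ), (∀ i, s (xs i) = num (v.get i)) →
    (∀ j, b ≤ j → s j = []) → y ∈ f v → P.Exec s (update s o (num y ++ s o))

/-- Functions computed by reversible programs. -/
def Implementable {n : ℕ} (f : List.Vector ℕ n →. ℕ) : Prop :=
  ∀ (xs : Fin n → ℕ) (o b : ℕ), (∀ i, xs i < b ∧ xs i ≠ o) → o < b → ∃ P, Implements f xs o b P

/-! ### Basic functions, composition, minimisation and recursion -/

theorem implementable_zero : Implementable (n := 0) fun _ => Part.some 0 := by
  -- There is no empty program; a push followed by its pop does nothing.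
  refine fun xs o b _ _ => ⟨seq (push o true) (pop o true), fun s v y _ _ hy => ?_⟩
  obtain rfl := Part.mem_some_iff.1 hy
  refine (exec_push rfl).seq (exec_pop (l := s o) (by simp) (by simp))

theorem implementable_get {n : ℕ} (i : Fin n) :
    Implementable fun v : List.Vector ℕ n => Part.some (v.get i) := by
  refine fun xs o b hxs ho => ⟨copy (xs i) o b, fun s v y hv hs hy => ?_⟩
  obtain rfl := Part.mem_some_iff.1 hy
  exact exec_copy (hxs i).1.ne (hxs i).2 ho.ne (hv i) (hs b le_rfl)

theorem implementable_succ : Implementable (n := 1) fun v => Part.some (v.head.succ) := by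
  refine fun xs o b hxs ho => ⟨seq (copy (xs 0) o b) (push o true), fun s v y hv hs hy => ?_⟩
  obtain rfl := Part.mem_some_iff.1 hy
  refine (exec_copy (hxs 0).1.ne (hxs 0).2 ho.ne (hv 0) (hs b le_rfl)).seq (exec_push ?_)
  simp [num_succ]

/-- The values of the `g i` are computed into the registers `b + i`, with scratch space from `b + m`
on, then `f` adds its value to `o`, and the intermediate values are uncomputed. Stating the
hypothesis `hh` through witnesses covers total and partial composition alike. -/
theorem implementable_comp {m n : ℕ} {f : List.Vector ℕ m →. ℕ}
    {g : Fin m → List.Vector ℕ n →. ℕ} {h : List.Vector ℕ n →. ℕ} (hf : Implementable f)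
    (hg : ∀ i, Implementable (g i))
    (hh : ∀ v y, y ∈ h v → ∃ w : List.Vector ℕ m, (∀ i, w.get i ∈ g i v) ∧ y ∈ f w) :
    Implementable h := by
  intro xs o b hxs ho
  have hP : ∀ i : Fin m, ∃ P, Implements (g i) xs (b + i) (b + m) P := fun i =>
    hg i xs (b + i) (b + m) (fun j => by have := (hxs j).1; omega) (by omega)
  choose P hP using hP
  obtain ⟨F, hF⟩ := hf (fun i => b + i) o (b + m)
    (fun i => ⟨by have := i.2; omega, by omega⟩) (by omega)
  -- `Q` computes the first `k` intermediate values side by side.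
  have hQ : ∀ k ≤ m, ∃ Q : Prog ℕ, ∀ (s : Store ℕ) (v : List.Vector ℕ n) (w : ℕ → ℕ),
      (∀ i, s (xs i) = num (v.get i)) → (∀ j, b ≤ j → s j = []) →
      (∀ i : Fin m, w i ∈ g i v) →
      Q.Exec s fun j => if b ≤ j ∧ j < b + k then num (w (j - b)) else s j := by
    intro k
    induction k with
    | zero =>
      refine fun _ => ⟨seq (push 0 true) (pop 0 true), fun s v w _ _ _ => ?_⟩
      refine (exec_push rfl).seq (exec_pop (l := s 0) (by simp) ?_)
      funext j
      rw [if_neg (by omega)]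
      simp
    | succ k ih =>
      intro hk
      obtain ⟨Q, hQ⟩ := ih (by omega)
      refine ⟨seq Q (P ⟨k, hk⟩), fun s v w hv hs hw => ?_⟩
      refine (hQ s v w hv hs hw).seq ((hP ⟨k, hk⟩ _ v (w k) ?_ ?_ (hw ⟨k, hk⟩)).of_eq ?_)
      · intro i
        have := (hxs i).1
        rw [if_neg (by omega), hv]
      · intro j hj
        rw [if_neg (by omega), hs j (by omega)]
      · funext j
        simp only [update_apply]
        by_cases h1 : j = b + k
        · subst h1
          simp [hs]
        · by_cases h2 : b ≤ j ∧ j < b + k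
          · rw [if_neg h1, if_pos h2, if_pos (by omega)]
          · rw [if_neg h1, if_neg h2, if_neg (by omega)]
  obtain ⟨Q, hQ⟩ := hQ m le_rfl
  refine ⟨seq Q (seq F Q.inv), fun s v y hv hs hy => ?_⟩
  obtain ⟨w, hw, hy⟩ := hh v y hy
  set W : ℕ → ℕ := fun j => if h : j < m then w.get ⟨j, h⟩ else 0 with hW
  have hWw : ∀ i : Fin m, W i = w.get i := fun i => by simp [hW]
  have hWg : ∀ i : Fin m, W i ∈ g i v := fun i => by rw [hWw]; exact hw i
  -- `Q` ignores `o`: run on the store with `o` already updated, it ends exactly where `F` ended.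
  -- Hence `Q.inv` cleans up.
  refine Exec.conj (hQ s v W hv hs hWg) (hF _ w y ?_ ?_ hy)
    ((hQ (update s o (num y ++ s o)) v W ?_ ?_ hWg).of_eq ?_)
  · intro i
    dsimp only
    rw [if_pos (by omega), Nat.add_sub_cancel_left, hWw]
  · intro j hj
    rw [if_neg (by omega), hs j (by omega)]
  · intro i
    rw [update_of_ne (hxs i).2, hv]
  · intro j hj
    rw [update_of_ne (by omega), hs j hj]
  · funext j
    simp only [update_apply]
    by_cases h1 : j = o
    · subst h1
      rw [if_neg (by omega), if_pos rfl, if_pos rfl, if_neg (by omega)]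
    · simp [h1]

/-- Between rounds, register `b` holds the candidate `j` and `b + 1` holds the value at `j`. A round
uncomputes the value, increments `j` and computes the new value. The entry test `j = 0` and the exit
test "value `0`" each hold only once, so the search can be undone after its result has been copied.
-/
theorem implementable_rfind {n : ℕ} {f : List.Vector ℕ (n + 1) →. ℕ} {h : List.Vector ℕ n →. ℕ}
    (hf : Implementable f)
    (hh : ∀ v y, y ∈ h v → ∃ ys : ℕ → ℕ, (∀ j ≤ y, ys j ∈ f (j ::ᵥ v)) ∧ ys y = 0 ∧
      ∀ j < y, ys j ≠ 0) : Implementable h := by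
  intro xs o b hxs ho
  obtain ⟨F, hF⟩ := hf (Fin.cons b xs) (b + 1) (b + 2)
    (Fin.cases (by simp) fun i => by have := hxs i; simp; omega) (by omega)
  obtain ⟨L, hL⟩ : ∃ L, L =
      seq F (loop (b, none) (seq F.inv (seq (push b true) F)) (b + 1, none)) := ⟨_, rfl⟩
  refine ⟨seq L (seq (copy b o (b + 2)) L.inv), fun s v y hv hs hy => ?_⟩
  obtain ⟨ys, hys, hy0, hlt⟩ := hh v y hy
  have key : ∀ s : Store ℕ, (∀ i, s (xs i) = num (v.get i)) → (∀ j, b ≤ j → s j = []) →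
      L.Exec s (update s b (num y)) := by
    intro s hv hs
    rw [hL]
    have hF' : ∀ j ≤ y, F.Exec (update s b (num j))
        (update (update s b (num j)) (b + 1) (num (ys j))) := by
      intro j hj
      refine (hF _ (j ::ᵥ v) (ys j) ?_ ?_ (hys j hj)).of_eq ?_
      · refine Fin.cases (by simp) fun i => ?_
        have := (hxs i).1
        simp [this.ne, hv]
      · intro k hk
        rw [update_of_ne (by omega), hs k (by omega)]
      · simp [hs]
    have hl := exec_loop (e₁ := (b, none)) (e₂ := (b + 1, none))
      (P := seq F.inv (seq (push b true) F))
      (fun j => update (update s b (num j)) (b + 1) (num (ys j))) y (by simp [TopTest.Holds])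
      (by simp [TopTest.Holds])
      (by simp [TopTest.Holds, hy0])
      (fun j hj => by simpa [TopTest.Holds, head?_num_eq_none] using hlt j hj)
      (fun j hj => by
        refine (hF' j (by omega)).inv.seq ((exec_push (s' := update s b (num (j + 1))) ?_).seq
          (hF' (j + 1) hj))
        simp [num_succ])
    refine (((hF' 0 (Nat.zero_le _)).of_eq_left ?_).seq hl).of_eq ?_
    · funext r
      simp only [update_apply]
      split_ifs <;> simp_all
    · funext r
      simp only [update_apply]
      split_ifs <;> simp_all
  refine Exec.conj (key s hv hs) (exec_copy (n := y) (by omega) (by omega) (by omega) (by simp)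
    (by rw [update_of_ne (by omega), hs _ (by omega)]))
    ((key (update s o (num y ++ s o)) ?_ ?_).of_eq ?_)
  · intro i
    rw [update_of_ne (hxs i).2, hv]
  · intro j hj
    rw [update_of_ne (by omega), hs j hj]
  · rw [update_comm (by omega), update_of_ne (a := o) (by omega)]

/-- The history of a recursion with values `Y 0, Y 1, …`. -/
def history (Y : ℕ → ℕ) : ℕ → List Bool
  | 0 => []
  | j + 1 => num (Y j) ++ false :: history Y j

/-- Recording the number in register `y` on the history in register `h`. -/
def record (y h : ℕ) : Prog ℕ :=
  -- The separator tells the inverse loop where the recorded number ends.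
  seq (push h false) (loop (h, some false) (seq (pop y true) (push h true)) (y, none))

theorem exec_record {y h n : ℕ} (hyh : y ≠ h) {s : Store ℕ} (hy : s y = num n) :
    (record y h).Exec s (update (update s y []) h (num n ++ false :: s h)) := by
  have := exec_loop (e₁ := (h, some false)) (e₂ := (y, none))
    (P := seq (pop y true) (push h true))
    (fun j => update (update s y (num (n - j))) h (num j ++ false :: s h)) n
    (by simp [TopTest.Holds])
    (by simp [TopTest.Holds, num_succ]) (by simp [TopTest.Holds, hyh])
    (fun j hj => by simp [TopTest.Holds, hyh]; omega)
    (fun j hj => by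
      refine (exec_pop (l := num (n - (j + 1))) ?_ rfl).seq (exec_push ?_)
      · simp [hyh, num_pos (Nat.sub_pos_of_lt hj), Nat.sub_sub]
      · funext r
        simp only [update_apply]
        split_ifs <;> simp_all [num_succ])
  refine (exec_push rfl).seq ((this.of_eq_left ?_).of_eq ?_)
  · funext r
    simp only [update_apply]
    split_ifs <;> simp_all
  · simp

/-- A step of the recursion need not be injective, so each old value is saved on a history stack,
and undoing the whole recursion after copying the result clears it. The registers from `b` on are:
rounds left, rounds done, current value, next value, history, scratch. -/
theorem implementable_prec {n : ℕ} {f : List.Vector ℕ n →. ℕ} {g : List.Vector ℕ (n + 2) →. ℕ}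
    {h : List.Vector ℕ (n + 1) →. ℕ} (hf : Implementable f) (hg : Implementable g)
    (hh : ∀ v y, y ∈ h v → ∃ Y : ℕ → ℕ, Y 0 ∈ f v.tail ∧
      (∀ j < v.head, Y (j + 1) ∈ g (j ::ᵥ Y j ::ᵥ v.tail)) ∧ Y v.head = y) :
    Implementable h := by
  intro xs o b hxs ho
  obtain ⟨F, hF⟩ := hf (fun i => xs i.succ) (b + 2) (b + 5)
    (fun i => by have := hxs i.succ; omega) (by omega)
  obtain ⟨G, hG⟩ := hg (Fin.cons (b + 1) (Fin.cons (b + 2) fun i => xs i.succ)) (b + 3) (b + 5)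
    (Fin.cases (by simp) (Fin.cases (by simp) fun i => by
      have := hxs i.succ; simp; omega)) (by omega)
  obtain ⟨body, hbody⟩ : ∃ B, B = seq G (seq (record (b + 2) (b + 4)) (seq (move (b + 3) (b + 2))
    (seq (push (b + 1) true) (pop b true)))) := ⟨_, rfl⟩
  obtain ⟨L, hL⟩ : ∃ L, L = seq (copy (xs 0) b (b + 5)) (seq F (loop (b + 1, none) body (b, none))) :=
    ⟨_, rfl⟩
  refine ⟨seq L (seq (copy (b + 2) o (b + 5)) L.inv), fun s v y hv hs hy => ?_⟩
  obtain ⟨Y, hY0, hY, rfl⟩ := hh v y hy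
  have hv0 : v.get 0 = v.head := List.Vector.get_zero v
  have hvs : ∀ i : Fin n, v.get i.succ = v.tail.get i := fun i => by simp
  generalize v.head = N at hY hv0 hy
  have key : ∀ s : Store ℕ, (∀ i, s (xs i) = num (v.get i)) → (∀ j, b ≤ j → s j = []) →
      L.Exec s (update (update (update s (b + 1) (num N)) (b + 2) (num (Y N))) (b + 4)
        (history Y N)) := by
    intro s hv hs
    have hl := exec_loop (e₁ := (b + 1, none)) (e₂ := (b, none)) (P := body)
      (fun j => update (update (update (update s b (num (N - j))) (b + 1) (num j))
        (b + 2) (num (Y j))) (b + 4) (history Y j)) N (by simp [TopTest.Holds])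
      (by simp [TopTest.Holds])
      (by simp [TopTest.Holds])
      (fun j hj => by simp [TopTest.Holds]; omega)
      (fun j hj => by
        rw [hbody]
        refine Exec.seq (hG _ (j ::ᵥ Y j ::ᵥ v.tail) (Y (j + 1)) ?_ ?_ (hY j hj))
          ((exec_record (n := Y j) (by omega) (by simp)).seq
          ((exec_move (n := Y (j + 1)) (by omega) (by simp [hs]) (by simp)).seq
          ((exec_push rfl).seq (exec_pop (l := num (N - (j + 1))) ?_ ?_))))
        · refine Fin.cases (by simp) (Fin.cases (by simp; rfl) fun i => ?_)
          have := (hxs i.succ).1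
          rw [Fin.cons_succ, Fin.cons_succ, update_of_ne (by omega), update_of_ne (by omega),
            update_of_ne (by omega), update_of_ne (by omega), hv, hvs]
          rfl
        · intro k hk
          rw [update_of_ne (by omega), update_of_ne (by omega),
            update_of_ne (by omega), update_of_ne (by omega), hs k (by omega)]
        · simp [num_pos (Nat.sub_pos_of_lt hj), Nat.sub_sub]
        · funext r
          rcases eq_or_ne r (b + 4) with rfl | h4
          · simp [history]
          rcases eq_or_ne r (b + 3) with rfl | h3
          · simp [hs]
          rcases eq_or_ne r (b + 2) with rfl | h2
          · simp
          rcases eq_or_ne r (b + 1) with rfl | h1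
          · simp [num_succ]
          rcases eq_or_ne r b with rfl | h0
          · simp
          simp [h0, h1, h2, h3, h4])
    rw [hL]
    refine (exec_copy (n := N) (by have := (hxs 0).1; omega) (by have := (hxs 0).1; omega)
      (by omega) (by rw [hv, hv0]) (hs _ (by omega))).seq
      ((hF _ v.tail (Y 0) ?_ ?_ hY0).seq ((hl.of_eq_left ?_).of_eq ?_))
    · intro i
      have := (hxs i.succ).1
      have h0 : xs i.succ ≠ b := by omega
      rw [update_of_ne h0, hv, hvs]
    · intro j hj
      rw [update_of_ne (by omega), hs j (by omega)]
    · funext r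
      rcases eq_or_ne r (b + 4) with rfl | h4
      · simp [history, hs]
      rcases eq_or_ne r (b + 2) with rfl | h2
      · simp [hs]
      rcases eq_or_ne r (b + 1) with rfl | h1
      · simp [hs]
      rcases eq_or_ne r b with rfl | h0
      · simp [hs]
      simp [h0, h1, h2, h4]
    · funext r
      rcases eq_or_ne r b with rfl | h0
      · simp [hs]
      simp [update_apply, h0]
  refine Exec.conj (key s hv hs) (exec_copy (n := Y N) (by omega) (by omega) (by omega) (by simp)
    (by rw [update_of_ne (by omega), update_of_ne (by omega), update_of_ne (by omega),
          hs _ (by omega)]))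
    ((key (update s o (num (Y N) ++ s o)) ?_ ?_).of_eq ?_)
  · intro i
    rw [update_of_ne (hxs i).2, hv]
  · intro j hj
    rw [update_of_ne (by omega), hs j hj]
  · funext r
    simp only [update_apply]
    split_ifs <;> first | rfl | omega

/-! ### Partial recursive functions are implementable -/

theorem mem_mOfFn {n : ℕ} {g : Fin n → Part ℕ} {w : List.Vector ℕ n}
    (h : w ∈ List.Vector.mOfFn g) (i : Fin n) : w.get i ∈ g i := by
  induction n with
  | zero => exact i.elim0
  | succ n ih =>
    simp only [List.Vector.mOfFn, Part.bind_eq_bind, Part.mem_bind_iff, Part.pure_eq_some,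
      Part.mem_some_iff] at h
    obtain ⟨a, ha, u, hu, rfl⟩ := h
    refine Fin.cases (by simpa using ha) (fun j => ?_) i
    simpa using ih hu j

theorem implementable_of_primrec' {n : ℕ} {f : List.Vector ℕ n → ℕ} (hf : Nat.Primrec' f) :
    Implementable fun v => Part.some (f v) := by
  induction hf with
  | zero => exact implementable_zero
  | succ => exact implementable_succ
  | get i => exact implementable_get i
  | comp g _ _ ihf ihg =>
    refine implementable_comp ihf ihg fun v y hy => ⟨_, fun i => ?_, hy⟩
    simp
  | @prec n f g _ _ ihf ihg =>
    refine implementable_prec ihf ihg fun v y hy => ?_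
    refine ⟨fun j => j.rec (f v.tail) fun y IH => g (y ::ᵥ IH ::ᵥ v.tail), by simp,
      fun j _ => by simp, (Part.mem_some_iff.1 hy).symm⟩

theorem implementable_of_partrec' {n : ℕ} {f : List.Vector ℕ n →. ℕ} (hf : Nat.Partrec' f) :
    Implementable f := by
  induction hf with
  | prim hf => exact implementable_of_primrec' hf
  | comp g _ _ ihf ihg =>
    refine implementable_comp ihf ihg fun v y hy => ?_
    obtain ⟨w, hw, hy⟩ := Part.mem_bind_iff.1 hy
    exact ⟨w, mem_mOfFn hw, hy⟩
  | @rfind n f _ ih =>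
    refine implementable_rfind ih fun v y hy => ?_
    refine ⟨fun j => f (j ::ᵥ v), fun j _ => by simp, ?_, fun j hj => ?_⟩
    · simpa using Nat.rfind_spec hy
    · simpa using Nat.rfind_min hy hj

end Prog
/-! ### Words and numbers -/

/-- The number of a word in the standard correspondence: the inverse of `natToWord`. -/
def wordToNat (w : Word) : ℕ := w.foldl (fun n b => 2 * n + 1 + b.toNat) 0

theorem wordToNat_append_singleton (w : Word) (b : Bool) :
    wordToNat (w ++ [b]) = 2 * wordToNat w + 1 + b.toNat := by
  simp [wordToNat]

/-- A positive number is `2 * n + 1 + b` for exactly one number `n` and bit `b`, so the last letter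
can be split off. -/
theorem wordToNat_injective : Injective wordToNat := by
  intro w
  induction w using List.reverseRecOn with
  | nil =>
    intro w'
    rcases List.eq_nil_or_concat w' with rfl | ⟨l, b, rfl⟩
    · simp
    · rw [List.concat_eq_append, wordToNat_append_singleton]
      intro h
      simp only [wordToNat, List.foldl_nil] at h
      omega
  | append_singleton w b ih =>
    intro w'
    rcases List.eq_nil_or_concat w' with rfl | ⟨l, b', rfl⟩
    · rw [wordToNat_append_singleton]
      intro h
      simp [wordToNat] at h
    · rw [List.concat_eq_append, wordToNat_append_singleton, wordToNat_append_singleton]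
      intro h
      have h1 : wordToNat w = wordToNat l ∧ b = b' := by
        cases b <;> cases b' <;> simp at h ⊢ <;> omega
      rw [ih h1.1, h1.2]

theorem wordToNat_natToWord (n : ℕ) : wordToNat (natToWord n) = n := by
  -- A word with a leading `1` put in front of it is the binary numeral of its number plus one.
  have key : ∀ k, k ≠ 0 → wordToNat ((Nat.bits k).dropLast).reverse + 1 = k := by
    intro k
    induction k using Nat.binaryRec' with
    | zero => simp
    | bit b k hk ih =>
      intro _
      rw [Nat.bits_append_bit k b hk]
      rcases eq_or_ne k 0 with rfl | h0
      · simp [hk rfl, wordToNat]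
      · have h1 : Nat.bits k ≠ [] := by
          intro h
          have := ih h0
          rw [h] at this
          have h2 : k = 1 := by simpa [wordToNat] using this.symm
          subst h2
          simp at h
        rw [List.dropLast_cons_of_ne_nil h1, List.reverse_cons, wordToNat_append_singleton,
          Nat.bit_val]
        have := ih h0
        omega
  have := key (n + 1) (by omega)
  unfold natToWord
  omega

theorem length_natToWord_le (n : ℕ) : (natToWord n).length ≤ Nat.log 2 (n + 1) := by
  have h : (n + 1).size ≤ Nat.log 2 (n + 1) + 1 :=
    Nat.size_le.2 (Nat.lt_pow_succ_log_self (by norm_num) _)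
  rw [← Nat.size_eq_bits_len] at h
  simp only [natToWord, List.length_reverse, List.length_dropLast]
  omega

theorem primrec_wordToNat : Primrec wordToNat := by
  refine Primrec.list_foldl (α := Word) (h := fun _ p => 2 * p.1 + 1 + p.2.toNat) Primrec.id
    (Primrec.const 0) ?_
  have h : Primrec Bool.toNat := Primrec.dom_finite _
  have h1 : Primrec fun p : Word × (ℕ × Bool) => p.2.1 := Primrec.fst.comp Primrec.snd
  have h2 : Primrec fun p : Word × (ℕ × Bool) => p.2.2 := Primrec.snd.comp Primrec.snd
  exact Primrec.nat_add.comp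
    (Primrec.succ.comp (Primrec.nat_mul.comp (Primrec.const 2) h1)) (h.comp h2)

/-! ### Reversible conversion of words into numbers -/

namespace Prog

/-- The store with a word in register `0` and numbers in the registers `1`, …, `4`. -/
def st (w : Word) (n m x y : ℕ) : Store ℕ
  | 0 => w
  | 1 => num n
  | 2 => num m
  | 3 => num x
  | 4 => num y
  | _ + 5 => []

theorem update_st_zero (w w' : Word) (n m x y : ℕ) :
    update (st w n m x y) 0 w' = st w' n m x y := by
  funext r; rcases r with _ | _ | _ | _ | _ | r <;> rfl

theorem update_st_one (w : Word) (n n' m x y : ℕ) :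
    update (st w n m x y) 1 (num n') = st w n' m x y := by
  funext r; rcases r with _ | _ | _ | _ | _ | r <;> rfl

theorem update_st_two (w : Word) (n m m' x y : ℕ) :
    update (st w n m x y) 2 (num m') = st w n m' x y := by
  funext r; rcases r with _ | _ | _ | _ | _ | r <;> rfl

theorem update_st_three (w : Word) (n m x x' y : ℕ) :
    update (st w n m x y) 3 (num x') = st w n m x' y := by
  funext r; rcases r with _ | _ | _ | _ | _ | r <;> rfl

theorem update_st_four (w : Word) (n m x y y' : ℕ) :
    update (st w n m x y) 4 (num y') = st w n m x y' := by
  funext r; rcases r with _ | _ | _ | _ | _ | r <;> rfl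

theorem exec_double (w : Word) (n : ℕ) :
    (loop (2, none) (seq (pop 1 true) (seq (push 2 true) (push 2 true))) (1, none)).Exec
      (st w n 0 0 0) (st w 0 (2 * n) 0 0) := by
  have := exec_loop (e₁ := (2, none)) (e₂ := (1, none))
    (P := seq (pop 1 true) (seq (push 2 true) (push 2 true)))
    (fun j => st w (n - j) (2 * j) 0 0) n (by simp [TopTest.Holds, st])
    (by simp [TopTest.Holds, st]) (by simp [TopTest.Holds, st])
    (fun j hj => by simp [TopTest.Holds, st]; omega)
    (fun j hj => by
      refine (exec_pop (l := num (n - (j + 1))) ?_ (update_st_one ..).symm).seq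
        ((exec_push (update_st_two (m' := 2 * j + 1) ..).symm).seq
          (exec_push (update_st_two ..).symm))
      simp only [st, num_pos (Nat.sub_pos_of_lt hj), Nat.sub_sub])
  simpa using this

/-- The loop serves as a conditional with at most one round: a `true` on top becomes `false`, and
register `3` remembers that this happened. The top is then `false` in any case and can be popped. -/
theorem exec_split (w : Word) (m : ℕ) (b : Bool) :
    (seq (loop (3, none) (seq (pop 0 true) (seq (push 0 false)
      (seq (push 3 true) (push 2 true)))) (0, some false)) (pop 0 false)).Exec
      (st (b :: w) 0 m 0 0) (st w 0 (m + b.toNat) b.toNat 0) := by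
  have h : (pop 0 false).Exec (st (false :: w) 0 (m + b.toNat) b.toNat 0)
      (st w 0 (m + b.toNat) b.toNat 0) := exec_pop (l := w) rfl (update_st_zero ..).symm
  refine Exec.seq ?_ h
  cases b
  · exact exec_loop (fun _ => st (false :: w) 0 m 0 0) 0 (by simp [TopTest.Holds, st]) (by simp)
      (by simp [TopTest.Holds, st]) (by simp) (by simp)
  · refine exec_loop (fun j => st ((j == 0) :: w) 0 (m + j) j 0) 1 (by simp [TopTest.Holds, st])
      (by simp [TopTest.Holds, st]) (by simp [TopTest.Holds, st]) (by simp [TopTest.Holds, st])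
      fun j hj => ?_
    obtain rfl : j = 0 := by omega
    refine (exec_pop (l := w) rfl (update_st_zero ..).symm).seq
      ((exec_push (update_st_zero ..).symm).seq
      ((exec_push (update_st_three (x' := 1) ..).symm).seq
      (exec_push (update_st_two (m' := m + 1) ..).symm)))

/-- Starting from `1` in register `4`, the loop subtracts `x` there while clearing register `3`; it
makes one round or none. -/
theorem exec_toggle (w : Word) (n m x : ℕ) (hx : x < 2) :
    (seq (push 4 true) (seq (loop (4, some true) (seq (pop 3 true) (pop 4 true)) (3, none))
      (move 4 3))).Exec (st w n m x 0) (st w n m (1 - x) 0) := by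
  refine (exec_push (update_st_four (y' := 1) ..).symm).seq (Exec.seq (t := st w n m 0 (1 - x)) ?_
    ((exec_move (x := 4) (t := 3) (n := 1 - x) (by decide) rfl rfl).of_eq ?_))
  · have := exec_loop (e₁ := (4, some true)) (e₂ := (3, none))
      (P := seq (pop 3 true) (pop 4 true))
      (fun j => st w n m (x - j) (1 - j)) x (by simp [TopTest.Holds, st])
      (fun j hj => by
        obtain rfl : j = 0 := by omega
        simp [TopTest.Holds, st])
      (by simp [TopTest.Holds, st])
      (fun j hj => by simp [TopTest.Holds, st]; omega)
      (fun j hj => by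
        obtain rfl : j = 0 := by omega
        obtain rfl : x = 1 := by omega
        exact (exec_pop (l := num 0) rfl (update_st_three ..).symm).seq
          (exec_pop (l := num 0) rfl (update_st_four ..).symm))
    simpa using this
  · rw [show ([] : List Bool) = num 0 from rfl, update_st_four, update_st_three]

theorem exec_parity (w : Word) (M x : ℕ) (hx : x < 2) :
    (loop (1, none) (seq (pop 2 true) (seq (push 1 true) (seq (push 4 true)
      (seq (loop (4, some true) (seq (pop 3 true) (pop 4 true)) (3, none)) (move 4 3)))))
      (2, none)).Exec (st w 0 M x 0) (st w M 0 ((x + M) % 2) 0) := by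
  have := exec_loop (e₁ := (1, none)) (e₂ := (2, none))
    (P := seq (pop 2 true) (seq (push 1 true) (seq (push 4 true)
      (seq (loop (4, some true) (seq (pop 3 true) (pop 4 true)) (3, none)) (move 4 3)))))
    (fun j => st w j (M - j) ((x + j) % 2) 0) M (by simp [TopTest.Holds, st])
    (by simp [TopTest.Holds, st]) (by simp [TopTest.Holds, st])
    (fun j hj => by simp [TopTest.Holds, st]; omega)
    (fun j hj => by
      refine (exec_pop (l := num (M - (j + 1))) ?_ (update_st_two ..).symm).seq
        ((exec_push (update_st_one (n' := j + 1) ..).symm).seq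
          ((exec_toggle _ _ _ _ (Nat.mod_lt _ (by norm_num))).of_eq ?_))
      · simp only [st, num_pos (Nat.sub_pos_of_lt hj), Nat.sub_sub]
      · congr 1
        omega)
  simpa [Nat.mod_eq_of_lt hx] using this

/-- A word can be converted reversibly into its number. -/
theorem exists_wordToNat : ∃ P : Prog ℕ, ∀ w : Word,
    P.Exec (st w 0 0 0 0) (st [] (wordToNat w) 0 0 0) := by
  obtain ⟨B, hB⟩ : ∃ B : Prog ℕ, ∀ (b : Bool) (w : Word) (n : ℕ),
      B.Exec (st (b :: w) n 0 0 0) (st w (2 * n + 1 + b.toNat) 0 0 0) := by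
    -- The copy of `b` left in register `3` must be erased reversibly. The new number `2 * n + 1 +
    -- b` has parity opposite to `b`, so adding its parity turns the copy into `1`, whatever `b` is.
    refine ⟨_, fun b w n => (exec_double (b :: w) n).seq ((exec_split w (2 * n) b).seq
      ((exec_push (update_st_two (m' := 2 * n + b.toNat + 1) ..).symm).seq
      ((exec_parity w _ _ (Bool.toNat_lt b)).seq (exec_pop (i := 3) (a := true) (l := num 0) ?_ ?_))))⟩
    · have : (b.toNat + (2 * n + b.toNat + 1)) % 2 = 1 := by omega
      simp only [st, this]
      rfl
    · rw [update_st_three]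
      congr 1
      omega
  -- Every round produces a positive number, so the number is `0` only at the start, as the entry
  -- test requires.
  refine ⟨loop (1, none) B (0, none), fun w => ?_⟩
  have := exec_loop (e₁ := (1, none)) (e₂ := (0, none)) (P := B)
    (fun j => st (w.drop j) (wordToNat (w.take j)) 0 0 0) w.length
    (by simp [TopTest.Holds, st, wordToNat])
    (fun j hj => by
      rw [List.take_succ_eq_append_getElem hj, wordToNat_append_singleton]
      simp [TopTest.Holds, st])
    (by simp [TopTest.Holds, st])
    (fun j hj => by simpa [TopTest.Holds, st] using hj)
    (fun j hj => by
      rw [List.take_succ_eq_append_getElem hj, wordToNat_append_singleton,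
        List.drop_eq_getElem_cons hj]
      exact hB _ _ _)
  simpa [wordToNat] using this

end Prog

open Prog in
/-- A partial recursive injection with a partial recursive inverse is computed by a reversible
machine. -/
theorem exists_reversible_of_partrec {F G : ℕ →. ℕ} (hF : Partrec F) (hG : Partrec G) :
    ∃ R : TM, R.IsReversible ∧ ∀ w v : Word, wordToNat v ∈ F (wordToNat w) →
      wordToNat w ∈ G (wordToNat v) → R.Computes w v := by
  have hF' := implementable_of_partrec' (Nat.Partrec'.part_iff₁.2 hF)
  have hG' := implementable_of_partrec' (Nat.Partrec'.part_iff₁.2 hG)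
  obtain ⟨P, hP⟩ := hF' (fun _ => 1) 2 3 (by simp) (by simp)
  obtain ⟨R, hR⟩ := hG' (fun _ => 2) 1 3 (by simp) (by simp)
  obtain ⟨W, hW⟩ := exists_wordToNat
  -- On numbers, `P` takes `(n, 0)` to `(n, F n)`. As `G (F n) = n`, the inverse of `R` then takes
  -- this to `(0, F n)`, which removes the input.
  obtain ⟨T, hT, hT'⟩ := exists_reversible_of_prog
    (seq W (seq P (seq R.inv (seq (move 2 1) W.inv))))
  refine ⟨T, hT, fun w v h1 h2 => hT' w v ?_⟩
  have hst : ∀ w : Word, wordStore 0 w = st w 0 0 0 0 := fun w => by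
    funext r; rcases r with _ | _ | _ | _ | _ | r <;> rfl
  rw [hst, hst]
  have hz : ∀ (w : Word) (n m : ℕ) (j : ℕ), 3 ≤ j → st w n m 0 0 j = [] := by
    intro w n m j hj
    rcases j with _ | _ | _ | _ | _ | j <;> first | rfl | omega
  refine (hW w).seq (((hP _ (wordToNat w ::ᵥ .nil) (wordToNat v) ?_ (hz _ _ _) h1).of_eq
    (t' := st [] (wordToNat w) (wordToNat v) 0 0) ?_).seq
    (Exec.seq (t := st [] 0 (wordToNat v) 0 0) (((hR _ (wordToNat v ::ᵥ .nil) (wordToNat w)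
      ?_ (hz _ _ _) h2).of_eq ?_).inv) (Exec.seq ((exec_move (x := 2) (t := 1) (n := wordToNat v) (by decide) rfl
      rfl).of_eq ?_) (hW v).inv)))
  · intro i
    obtain rfl : i = 0 := Subsingleton.elim _ _
    rfl
  · rw [show st [] (wordToNat w) 0 0 0 2 = [] from rfl, List.append_nil, update_st_two]
  · intro i
    obtain rfl : i = 0 := Subsingleton.elim _ _
    rfl
  · rw [show st [] 0 (wordToNat v) 0 0 1 = [] from rfl, List.append_nil, update_st_one]
  · rw [show ([] : List Bool) = num 0 from rfl, update_st_two, update_st_one]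

/-! ### Inverting partial recursive functions -/

/-- A partial recursive function has a partial recursive right inverse on its range. -/
theorem exists_selector {α β : Type*} [Primcodable α] [Primcodable β] {G : α →. β}
    (hG : Partrec G) : ∃ h : β →. α, Partrec h ∧ (∀ a b, a ∈ h b → b ∈ G a) ∧
      ∀ a b, b ∈ G a → (h b).Dom := by
  classical
  obtain ⟨c, hc⟩ := Nat.Partrec.Code.exists_code.1 hG
  have hc' : ∀ a b, b ∈ G a ↔ Encodable.encode b ∈ c.eval (Encodable.encode a) := fun a b => by
    rw [hc]
    simp
  -- Dovetailing: `k` codes a candidate argument together with an evaluation bound.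
  let f : β → ℕ → Option α := fun b k => (Encodable.decode (α := α) k.unpair.1).bind fun a =>
    if Nat.Partrec.Code.evaln k.unpair.2 c (Encodable.encode a) = some (Encodable.encode b)
    then some a else none
  have hf : Primrec₂ f := by
    refine Primrec.option_bind (Primrec.decode.comp (Primrec.fst.comp
      (Primrec.unpair.comp Primrec.snd))) ?_
    refine Primrec.ite (Primrec.eq.comp (Nat.Partrec.Code.primrec_evaln.comp
      (((Primrec.snd.comp (Primrec.unpair.comp (Primrec.snd.comp Primrec.fst))).pair
        (Primrec.const c)).pair (Primrec.encode.comp Primrec.snd)))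
      (Primrec.option_some.comp (Primrec.encode.comp (Primrec.fst.comp Primrec.fst))))
      (Primrec.option_some.comp Primrec.snd) (Primrec.const none)
  refine ⟨fun b => Nat.rfindOpt (f b), Partrec.rfindOpt hf.to_comp, fun a b hab => ?_,
    fun a b hab => ?_⟩
  · obtain ⟨k, hk⟩ := Nat.rfindOpt_spec hab
    simp only [f, Option.mem_def, Option.bind_eq_some_iff, Option.ite_none_right_eq_some] at hk
    obtain ⟨a', _, h2, h3⟩ := hk
    obtain rfl : a' = a := by simpa using h3
    exact (hc' _ _).2 (Nat.Partrec.Code.evaln_sound h2)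
  · obtain ⟨k, hk⟩ := Nat.Partrec.Code.evaln_complete.1 ((hc' _ _).1 hab)
    refine Nat.rfindOpt_dom.2 ⟨Nat.pair (Encodable.encode a) k, a, ?_⟩
    simpa [f] using hk

/-! ### Simulating Turing machines -/

/-- Deleting the blanks at the end of a list. -/
def strip {B : Type} [DecidableEq B] (l : List (Option B)) : List (Option B) :=
  l.foldr (fun a l => if a = none ∧ l = [] then [] else a :: l) []

section Strip

variable {B : Type} [DecidableEq B]

theorem strip_cons (a : Option B) (l : List (Option B)) :
    strip (a :: l) = if a = none ∧ strip l = [] then [] else a :: strip l := rfl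

theorem mk_strip (l : List (Option B)) :
    Turing.ListBlank.mk (strip l) = Turing.ListBlank.mk l := by
  induction l with
  | nil => rfl
  | cons a l ih =>
    rw [strip_cons]
    split_ifs with h
    · rw [← Turing.ListBlank.cons_mk, ← ih, h.1, h.2, Turing.ListBlank.cons_mk]
      exact Quotient.sound' (Or.inl ⟨1, rfl⟩)
    · rw [← Turing.ListBlank.cons_mk, ← Turing.ListBlank.cons_mk, ih]

theorem strip_append_replicate (l : List (Option B)) (n : ℕ) :
    strip (l ++ List.replicate n none) = strip l := by
  induction l with
  | nil =>
    induction n with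
    | zero => rfl
    | succ n ih =>
      rw [List.nil_append] at ih ⊢
      rw [List.replicate_succ, strip_cons, ih]
      simp [strip]
  | cons a l ih => rw [List.cons_append, strip_cons, strip_cons, ih]

/-- Stripped lists are canonical representatives, which reduces equality of half-tapes to equality
of lists. -/
theorem mk_eq_mk_iff {l l' : List (Option B)} :
    Turing.ListBlank.mk l = Turing.ListBlank.mk l' ↔ strip l = strip l' := by
  refine ⟨fun h => ?_, fun h => by rw [← mk_strip l, h, mk_strip]⟩
  have key : ∀ l l' : List (Option B), Turing.BlankExtends l l' → strip l = strip l' := by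
    rintro l l' ⟨n, rfl⟩
    exact (strip_append_replicate _ _).symm
  rcases (Quotient.exact' h : Turing.BlankRel l l') with h | h
  · exact key _ _ h
  · exact (key _ _ h).symm

theorem strip_map_some (l : List B) : strip (l.map some) = l.map some := by
  induction l with
  | nil => rfl
  | cons a l ih => rw [List.map_cons, strip_cons, ih]; simp

theorem mk₂_eq_mk₂_iff {L R L' R' : List (Option B)} :
    Turing.Tape.mk₂ L R = Turing.Tape.mk₂ L' R' ↔ strip L = strip L' ∧ strip R = strip R' := by
  rw [← mk_eq_mk_iff, ← mk_eq_mk_iff]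
  refine ⟨fun h => ⟨?_, ?_⟩, fun h => by rw [Turing.Tape.mk₂, h.1, h.2]; rfl⟩
  · simpa [Turing.Tape.mk₂] using congrArg Turing.Tape.left h
  · simpa [Turing.Tape.mk₂] using congrArg Turing.Tape.right₀ h

end Strip

/-- This exposes the number of steps, so that a computation can search for it. -/
theorem reaches_iff_iterate {σ : Type*} {f : σ → Option σ} {a b : σ} :
    Reaches f a b ↔ ∃ t : ℕ, (fun o : Option σ => o.bind f)^[t] (some a) = some b := by
  constructor
  · intro h
    induction h with
    | refl => exact ⟨0, rfl⟩
    | tail _ h ih =>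
      obtain ⟨t, ht⟩ := ih
      exact ⟨t + 1, by rw [Function.iterate_succ_apply', ht]; exact h⟩
  · rintro ⟨t, ht⟩
    induction t generalizing b with
    | zero =>
      obtain rfl : a = b := by simpa using ht
      exact .refl
    | succ t ih =>
      rw [Function.iterate_succ_apply', Option.bind_eq_some_iff] at ht
      obtain ⟨c, hc, hcb⟩ := ht
      exact (ih hc).tail hcb

/-! ### Injectivity of reversible machines and recognition of their runs -/

namespace TM

theorem wordCfg_injective (M : TM) (q : M.Q) : Function.Injective (M.wordCfg q) := by
  classical
  intro w w' h
  have h1 := congrFun (congrArg Cfg.tapes h) M.io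
  simp only [wordCfg, if_true, Turing.Tape.mk₁, mk₂_eq_mk₂_iff] at h1
  have h2 := h1.2
  rw [← Function.comp_def some, ← List.map_map, ← List.map_map, strip_map_some, strip_map_some] at h2
  exact List.map_injective_iff.2 Sum.inl_injective
    (List.map_injective_iff.2 (Option.some_injective _) h2)

/-- A reversible machine computes an injective function. -/
theorem IsReversible.computes_inj {M : TM} (hM : M.IsReversible) {w w' v : Word}
    (h : M.Computes w v) (h' : M.Computes w' v) : w = w' := by
  have hstart : ∀ c u, Reaches M.step c (M.wordCfg M.start u) → c = M.wordCfg M.start u := by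
    intro c u h
    rcases Relation.ReflTransGen.cases_tail h with h | ⟨d, _, h⟩
    · exact h.symm
    · simp only [Option.mem_def, TM.step, Option.map_eq_some_iff] at h
      obtain ⟨r, hr, h⟩ := h
      exact absurd (congrArg Cfg.state h) (hM.2 _ _ _ hr)
  -- Backward steps are deterministic, so of two backward runs from the same configuration one
  -- continues the other. A start configuration has no predecessor, so both end at the same one.
  have key := Relation.ReflTransGen.total_of_right_unique
    (r := Function.swap fun a b => b ∈ M.step a)
    (fun a b c hb hc => hM.1 _ _ _ hb hc) h.swap h'.swap
  rcases key with h | h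
  · exact M.wordCfg_injective _ (hstart _ _ h.swap).symm
  · exact M.wordCfg_injective _ (hstart _ _ h.swap)

/-- The effect of a transition on a tape that is given by two lists. -/
def listAct {S : Type} (a : Option S × Option Turing.Dir) (p : List (Option S) × List (Option S)) :
    List (Option S) × List (Option S) :=
  if a.2 = some .left then (p.1.tail, p.1.headI :: a.1 :: p.2.tail)
  else if a.2 = some .right then (a.1 :: p.1, p.2.tail) else (p.1, a.1 :: p.2.tail)

theorem mk₂_listAct {S : Type} (a : Option S × Option Turing.Dir)
    (p : List (Option S) × List (Option S)) :
    Turing.Tape.mk₂ (listAct a p).1 (listAct a p).2 =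
      moveHead a.2 ((Turing.Tape.mk₂ p.1 p.2).write a.1) := by
  obtain ⟨a, _ | _ | _⟩ := a <;> simp [listAct, moveHead, Turing.Tape.mk₂]

instance : Primcodable Turing.Dir :=
  Primcodable.ofEquiv Bool ⟨fun d => d = .left, fun b => if b then .left else .right,
    fun d => by cases d <;> rfl, fun b => by cases b <;> rfl⟩

theorem primrec_listAct {S : Type} [Primcodable S] :
    Primrec₂ (listAct : Option S × Option Turing.Dir → _ → _) := by
  classical
  have h1 : Primrec fun x : (Option S × Option Turing.Dir) × (List (Option S) × List (Option S)) =>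
      x.1.2 := Primrec.snd.comp Primrec.fst
  have h2 : Primrec fun x : (Option S × Option Turing.Dir) × (List (Option S) × List (Option S)) =>
      x.1.1 := Primrec.fst.comp Primrec.fst
  have h3 : Primrec fun x : (Option S × Option Turing.Dir) × (List (Option S) × List (Option S)) =>
      x.2.1 := Primrec.fst.comp Primrec.snd
  have h4 : Primrec fun x : (Option S × Option Turing.Dir) × (List (Option S) × List (Option S)) =>
      x.2.2.tail := Primrec.list_tail.comp (Primrec.snd.comp Primrec.snd)
  have h5 := Primrec.list_cons.comp h2 h4
  refine Primrec.ite (Primrec.eq.comp h1 (Primrec.const _))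
    ((Primrec.list_tail.comp h3).pair (Primrec.list_cons.comp (Primrec.list_headI.comp h3) h5))
    (Primrec.ite (Primrec.eq.comp h1 (Primrec.const _))
      ((Primrec.list_cons.comp h2 h3).pair h4) (h3.pair h5))

theorem primrec_strip {B : Type} [Primcodable B] [DecidableEq B] :
    Primrec (strip : List (Option B) → _) := by
  refine Primrec.list_foldr (h := fun _ p => if p.1 = none ∧ p.2 = [] then [] else p.1 :: p.2)
    Primrec.id (Primrec.const []) ?_
  have h1 : Primrec fun p : List (Option B) × (Option B × List (Option B)) => p.2.1 :=
    Primrec.fst.comp Primrec.snd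
  have h2 : Primrec fun p : List (Option B) × (Option B × List (Option B)) => p.2.2 :=
    Primrec.snd.comp Primrec.snd
  exact Primrec.ite ((Primrec.eq.comp h1 (Primrec.const _)).and (Primrec.eq.comp h2 (Primrec.const _)))
    (Primrec.const _) (Primrec.list_cons.comp h1 h2)

/-- It can be checked whether a machine turns `w` into `v` in `t` steps. -/
theorem exists_primrec_computes (M : TM) : ∃ f : (Word × Word) × ℕ → Bool, Primrec f ∧
    ∀ w v, M.Computes w v ↔ ∃ t, f ((w, v), t) = true := by
  classical
  have := M.finQ
  have := M.finι
  have := M.finA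
  obtain ⟨_, ⟨eQ⟩⟩ := Finite.exists_equiv_fin M.Q
  obtain ⟨_, ⟨eA⟩⟩ := Finite.exists_equiv_fin M.A
  obtain ⟨k, ⟨e⟩⟩ := Finite.exists_equiv_fin M.ι
  let : Primcodable M.Q := Primcodable.ofEquiv _ eQ
  let : Primcodable M.A := Primcodable.ofEquiv _ eA
  let S := Option (Bool ⊕ M.A)
  let C := M.Q × (Fin k → List S × List S)
  let toCfg : C → M.Cfg := fun c => ⟨c.1, fun i => Turing.Tape.mk₂ (c.2 (e i)).1 (c.2 (e i)).2⟩
  let δ' : M.Q × (Fin k → S) → Option (M.Q × (Fin k → S × Option Turing.Dir)) := fun p =>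
    (M.δ p.1 (p.2 ∘ e)).map fun r => (r.1, r.2 ∘ e.symm)
  let stepC : C → Option C := fun c => (δ' (c.1, fun j => (c.2 j).2.headI)).map fun r =>
    (r.1, fun j => listAct (r.2 j) (c.2 j))
  let init : M.Q → Word → C := fun q w =>
    (q, fun j => ([], if j = e M.io then w.map (fun b => some (Sum.inl b)) else []))
  -- Different lists may describe the same tape; `norm` makes arrival at the final configuration a
  -- decidable equality.
  let norm : C → C := fun c => (c.1, fun j => (strip (c.2 j).1, strip (c.2 j).2))
  have hstep : ∀ c, M.step (toCfg c) = (stepC c).map toCfg := by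
    intro c
    simp only [TM.step, stepC, δ', toCfg, Option.map_map]
    have : (fun i => (Turing.Tape.mk₂ (c.2 (e i)).1 (c.2 (e i)).2).head) =
        (fun j => (c.2 j).2.headI) ∘ e := by
      funext i
      simp [Turing.Tape.mk₂]
    rw [this]
    congr 1
    funext r
    simp [mk₂_listAct]
  have hiter : ∀ (t : ℕ) (o : Option C), (fun o : Option M.Cfg => o.bind M.step)^[t] (o.map toCfg) =
      ((fun o : Option C => o.bind stepC)^[t] o).map toCfg := by
    intro t
    induction t with
    | zero => exact fun _ => rfl
    | succ t ih =>
      intro o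
      rw [Function.iterate_succ_apply, Function.iterate_succ_apply, ← ih]
      congr 1
      cases o with
      | none => rfl
      | some c => exact hstep c
  have hinit : ∀ q w, M.wordCfg q w = toCfg (init q w) := by
    intro q w
    simp only [wordCfg, toCfg, init, Turing.Tape.mk₁, e.injective.eq_iff]
  have hnorm : ∀ c c', toCfg c = toCfg c' ↔ norm c = norm c' := by
    rintro ⟨q, T⟩ ⟨q', T'⟩
    simp only [toCfg, norm, Cfg.mk.injEq, funext_iff, mk₂_eq_mk₂_iff]
    refine Iff.trans ?_ Prod.mk_inj.symm
    refine and_congr_right fun _ => ⟨fun h => funext fun j => ?_, fun h i => ?_⟩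
    · exact Prod.ext (by simpa using (h (e.symm j)).1) (by simpa using (h (e.symm j)).2)
    · exact Prod.mk_inj.1 (congrFun h (e i))
  have pδ : Primrec δ' := Primrec.dom_finite _
  have pstep : Primrec stepC := by
    refine Primrec.option_map (pδ.comp (Primrec.fst.pair (Primrec.fin_curry.2 ?_))) ?_
    · exact Primrec.list_headI.comp (Primrec.snd.comp
        (Primrec.fin_app.comp (Primrec.snd.comp Primrec.fst) Primrec.snd))
    · refine (Primrec.fst.comp Primrec.snd).pair (Primrec.fin_curry.2 ?_)
      exact primrec_listAct.comp
        (Primrec.fin_app.comp (Primrec.snd.comp (Primrec.snd.comp Primrec.fst)) Primrec.snd)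
        (Primrec.fin_app.comp (Primrec.snd.comp (Primrec.fst.comp Primrec.fst)) Primrec.snd)
  have pinit : ∀ q, Primrec (init q) := by
    intro q
    refine (Primrec.const q).pair (Primrec.fin_curry.2 ((Primrec.const []).pair ?_))
    refine Primrec.ite (Primrec.eq.comp Primrec.snd (Primrec.const _))
      (Primrec.list_map Primrec.fst ?_) (Primrec.const [])
    exact Primrec.option_some.comp (Primrec.sumInl.comp Primrec.snd)
  have pnorm : Primrec norm := by
    refine Primrec.fst.pair (Primrec.fin_curry.2 ?_)
    have := Primrec.fin_app.comp (Primrec.snd.comp (Primrec.fst (α := C) (β := Fin k))) Primrec.snd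
    exact (primrec_strip.comp (Primrec.fst.comp this)).pair
      (primrec_strip.comp (Primrec.snd.comp this))
  refine ⟨fun p => decide (((fun o : Option C => o.bind stepC)^[p.2]
    (some (init M.start p.1.1))).map norm = some (norm (init M.final p.1.2))), ?_, fun w v => ?_⟩
  · refine (PrimrecPred.decide (Primrec.eq.comp (Primrec.option_map (Primrec.nat_iterate Primrec.snd
      (Primrec.option_some.comp ((pinit _).comp (Primrec.fst.comp Primrec.fst))) ?_) ?_)
      (Primrec.option_some.comp (pnorm.comp ((pinit _).comp (Primrec.snd.comp Primrec.fst))))))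
    · exact Primrec.option_bind Primrec.snd (pstep.comp Primrec.snd)
    · exact pnorm.comp Primrec.snd
  · unfold Computes
    rw [reaches_iff_iterate]
    refine exists_congr fun t => ?_
    have h1 := hiter t (some (init M.start w))
    rw [Option.map_some, ← hinit] at h1
    rw [h1, hinit]
    simp only [decide_eq_true_eq, Option.map_eq_some_iff, hnorm]

end TM

/-- A partial recursive enumeration of the graph of a function makes the function partial
recursive. -/
theorem exists_partrec_of_pairs {α β γ : Type*} [Primcodable α] [Primcodable β] [Primcodable γ]
    {G : α →. β × γ} (hG : Partrec G)
    (h : ∀ a a' b c c', (b, c) ∈ G a → (b, c') ∈ G a' → c = c') :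
    ∃ F : β →. γ, Partrec F ∧ ∀ a b c, (b, c) ∈ G a → c ∈ F b := by
  -- Given `b`, search for some `a` whose pair begins with `b`. By `h` every such `a` yields the
  -- same second component.
  obtain ⟨s, hs, hs1, hs2⟩ := exists_selector
    (hG.map (f := G) (g := fun _ p => p.1) (Computable.fst.comp Computable.snd).to₂)
  refine ⟨fun b => (s b).bind fun a => (G a).map Prod.snd, hs.bind ((hG.comp Computable.snd).map
    (Computable.snd.comp Computable.snd).to₂).to₂, fun a b c hc => ?_⟩
  have hd := hs2 a b (Part.mem_map_iff _ |>.2 ⟨_, hc, rfl⟩)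
  obtain ⟨a', ha'⟩ := Part.dom_iff_mem.1 hd
  obtain ⟨⟨b', c'⟩, h1, rfl⟩ := (Part.mem_map_iff _).1 (hs1 _ _ ha')
  obtain rfl := h _ _ _ _ _ hc h1
  exact Part.mem_bind_iff.2 ⟨a', ha', (Part.mem_map_iff _).2 ⟨_, h1, rfl⟩⟩

/-- A recursively enumerable injection of words is computed by a reversible machine. -/
theorem exists_reversible_of_pairs {α : Type*} [Primcodable α] {G : α →. Word × Word}
    (hG : Partrec G) (h : ∀ a a' w v v', (w, v) ∈ G a → (w, v') ∈ G a' → v = v')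
    (h' : ∀ a a' w w' v, (w, v) ∈ G a → (w', v) ∈ G a' → w = w') :
    ∃ R : TM, R.IsReversible ∧ ∀ a w v, (w, v) ∈ G a → R.Computes w v := by
  have hc := primrec_wordToNat.to_comp
  obtain ⟨F, hF, hF'⟩ := exists_partrec_of_pairs (β := ℕ) (γ := ℕ)
    (G := fun a => (G a).map fun p => (wordToNat p.1, wordToNat p.2))
    (hG.map ((hc.comp (Computable.fst.comp Computable.snd)).pair
      (hc.comp (Computable.snd.comp Computable.snd))).to₂) (by
      intro a a' b c c' h1 h2
      obtain ⟨⟨w, v⟩, h1, e1⟩ := (Part.mem_map_iff _).1 h1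
      obtain ⟨⟨w', v'⟩, h2, e2⟩ := (Part.mem_map_iff _).1 h2
      simp only [Prod.mk.injEq] at e1 e2
      obtain rfl := wordToNat_injective (e1.1.trans e2.1.symm)
      rw [← e1.2, ← e2.2, h _ _ _ _ _ h1 h2])
  obtain ⟨F', hF₁, hF₁'⟩ := exists_partrec_of_pairs (β := ℕ) (γ := ℕ)
    (G := fun a => (G a).map fun p => (wordToNat p.2, wordToNat p.1))
    (hG.map ((hc.comp (Computable.snd.comp Computable.snd)).pair
      (hc.comp (Computable.fst.comp Computable.snd))).to₂) (by
      intro a a' b c c' h1 h2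
      obtain ⟨⟨w, v⟩, h1, e1⟩ := (Part.mem_map_iff _).1 h1
      obtain ⟨⟨w', v'⟩, h2, e2⟩ := (Part.mem_map_iff _).1 h2
      simp only [Prod.mk.injEq] at e1 e2
      obtain rfl := wordToNat_injective (e1.1.trans e2.1.symm)
      rw [← e1.2, ← e2.2, h' _ _ _ _ _ h1 h2])
  obtain ⟨R, hR, hR'⟩ := exists_reversible_of_partrec hF hF₁
  exact ⟨R, hR, fun a w v hwv => hR' w v
    (hF' a _ _ ((Part.mem_map_iff _).2 ⟨_, hwv, rfl⟩))
    (hF₁' a _ _ ((Part.mem_map_iff _).2 ⟨_, hwv, rfl⟩))⟩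

/-! ### Pairing -/

theorem replicate_append_inj {m m' : ℕ} {r r' : Word}
    (h : List.replicate m true ++ false :: r = List.replicate m' true ++ false :: r') :
    m = m' ∧ r = r' := by
  induction m generalizing m' with
  | zero => cases m' <;> simp_all [List.replicate_succ]
  | succ m ih =>
    cases m' with
    | zero => simp [List.replicate_succ] at h
    | succ m' =>
      simp only [List.replicate_succ, List.cons_append, List.cons.injEq, true_and] at h
      simpa using ih h

theorem pair_inj {x y x' y' : Word} (h : pair x y = pair x' y') : x = x' ∧ y = y' := by
  obtain ⟨h1, h2⟩ := replicate_append_inj h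
  exact List.append_inj h2 h1

theorem primrec_replicate_true : Primrec fun m : ℕ => List.replicate m true :=
  (Primrec.list_map Primrec.list_range (Primrec.const true).to₂).of_eq fun m => by simp

theorem primrec_pair : Primrec₂ pair :=
  Primrec.list_append.comp (primrec_replicate_true.comp (Primrec.list_length.comp Primrec.fst))
    (Primrec.list_cons.comp (Primrec.const false) (Primrec.list_append.comp Primrec.fst Primrec.snd))

theorem length_pair (x y : Word) : (pair x y).length = 2 * x.length + 1 + y.length := by
  simp [pair]; omega

/-! ### Complexity bounds -/

theorem condComplexity_le {U : Word →. Word} {x y p : Word} (h : x ∈ U (pair p y)) :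
    condComplexity U x y ≤ p.length := iInf₂_le p h

/-- `ℕ∞` is well-ordered, so the infimum is attained; being finite, it is not attained at a string
that fails to be a program for `x`, where the inner infimum is `⊤`. -/
theorem exists_of_condComplexity_eq {U : Word →. Word} {x y : Word} {n : ℕ}
    (h : condComplexity U x y = n) : ∃ p, x ∈ U (pair p y) ∧ p.length = n := by
  classical
  obtain ⟨p, hp⟩ := ciInf_mem fun p : Word => ⨅ _ : x ∈ U (pair p y), (p.length : ℕ∞)
  have hp' := hp.trans h
  dsimp only at hp'
  rw [iInf_eq_if] at hp'
  split_ifs at hp' with h1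
  · exact ⟨p, h1, by exact_mod_cast hp'⟩
  · simp at hp'

theorem TM.irrevCost_le {M : TM} {x y p q : Word} (h : M.Computes (pair x p) (pair y q)) :
    M.irrevCost x y ≤ (p.length + q.length : ℕ) :=
  (iInf_le _ p).trans (iInf₂_le q h)

theorem TM.exists_of_irrevCost_eq {M : TM} {x y : Word} {e : ℕ} (h : M.irrevCost x y = e) :
    ∃ p q, M.Computes (pair x p) (pair y q) ∧ p.length + q.length = e := by
  classical
  obtain ⟨p, hp⟩ := ciInf_mem fun p : Word => ⨅ (q : Word) (_ : M.Computes (pair x p) (pair y q)),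
    ((p.length + q.length : ℕ) : ℕ∞)
  obtain ⟨q, hq⟩ := ciInf_mem fun q : Word => ⨅ _ : M.Computes (pair x p) (pair y q),
    ((p.length + q.length : ℕ) : ℕ∞)
  have hq' := (hq.trans hp).trans h
  dsimp only at hq'
  rw [iInf_eq_if] at hq'
  split_ifs at hq' with h1
  · exact ⟨p, q, h1, by exact_mod_cast hq'⟩
  · simp at hq'

/-- The complexity with respect to a universal machine is minimal up to a constant. -/
theorem IsUniversal.exists_condComplexity_le {U : Word →. Word} (hU : IsUniversal U)
    {F : Word × Word →. Word} (hF : Partrec F) :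
    ∃ c : ℕ, ∀ p y x, x ∈ F (p, y) → condComplexity U x y ≤ (p.length + c : ℕ) := by
  obtain ⟨T, hT, hT'⟩ := exists_partrec_of_pairs (β := Word) (γ := Word)
    (G := fun a : Word × Word => (F a).map fun x => (pair a.1 a.2, x))
    (hF.map ((primrec_pair.to_comp.comp (Computable.fst.comp Computable.fst)
      (Computable.snd.comp Computable.fst)).pair Computable.snd).to₂) (by
      intro a a' b c c' h1 h2
      obtain ⟨x, h1, e1⟩ := (Part.mem_map_iff _).1 h1
      obtain ⟨x', h2, e2⟩ := (Part.mem_map_iff _).1 h2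
      simp only [Prod.mk.injEq] at e1 e2
      obtain ⟨h3, h4⟩ := pair_inj (e1.1.trans e2.1.symm)
      obtain rfl : a = a' := Prod.ext h3 h4
      rw [← e1.2, ← e2.2, Part.mem_unique h1 h2])
  obtain ⟨i, hi⟩ := hU.2 T hT
  -- The pairing spends `2 * |i| + 1` bits on the index `i`.
  refine ⟨2 * i.length + 1, fun p y x hx => ?_⟩
  have h1 : x ∈ U (pair (pair i p) y) := by
    rw [hi]
    exact hT' (p, y) _ _ ((Part.mem_map_iff _).2 ⟨x, hx, rfl⟩)
  refine (condComplexity_le h1).trans ?_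
  rw [length_pair, add_comm]

/-- The conditional complexity of a word is at most its length, up to a constant. -/
theorem IsUniversal.exists_condComplexity_le_length {U : Word →. Word} (hU : IsUniversal U) :
    ∃ c : ℕ, ∀ x y, condComplexity U x y ≤ (x.length + c : ℕ) := by
  obtain ⟨c, hc⟩ := hU.exists_condComplexity_le (F := fun a => Part.some a.1) Computable.fst.partrec
  exact ⟨c, fun x y => hc x y x (Part.mem_some _)⟩

/-- Erasing a record costs at least its complexity. -/
theorem IsUniversal.exists_complexity_le_irrevCost {U : Word →. Word} (hU : IsUniversal U)
    {M : TM} (hM : M.IsReversible) : ∃ c : ℕ, ∀ x p q,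
      M.Computes (pair x p) (pair [] q) → complexity U x ≤ (q.length + c : ℕ) := by
  obtain ⟨f, hf, hf'⟩ := M.exists_primrec_computes
  -- The graph of `q ↦ x`, enumerated by tuples `((x, p), (q, t))` in which `t` certifies that `M`
  -- turns `⟨x, p⟩` into `⟨ε, q⟩`. It is single-valued because `M` is injective.
  obtain ⟨F, hF, hF'⟩ := exists_partrec_of_pairs (α := (Word × Word) × (Word × ℕ)) (β := Word)
    (γ := Word)
    (G := fun a => ((if f ((pair a.1.1 a.1.2, pair [] a.2.1), a.2.2) = true then some (a.2.1, a.1.1)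
      else none : Option (Word × Word)) : Part (Word × Word))) (by
      refine Computable.ofOption (Primrec.to_comp (Primrec.ite (Primrec.eq.comp (hf.comp
        (((primrec_pair.comp (Primrec.fst.comp Primrec.fst) (Primrec.snd.comp Primrec.fst)).pair
          (primrec_pair.comp (Primrec.const []) (Primrec.fst.comp Primrec.snd))).pair
          (Primrec.snd.comp Primrec.snd))) (Primrec.const true))
        (Primrec.option_some.comp ((Primrec.fst.comp Primrec.snd).pair
          (Primrec.fst.comp Primrec.fst))) (Primrec.const none)))) (by
      intro a a' b c c' h1 h2
      simp only [Part.mem_ofOption, Option.mem_def, Option.ite_none_right_eq_some,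
        Option.some.injEq, Prod.mk.injEq] at h1 h2
      obtain ⟨h1, e1, rfl⟩ := h1
      obtain ⟨h2, e2, rfl⟩ := h2
      have k1 := (hf' _ _).2 ⟨_, h1⟩
      have k2 := (hf' _ _).2 ⟨_, h2⟩
      rw [e1] at k1
      rw [e2] at k2
      exact (pair_inj (hM.computes_inj k1 k2)).1)
  obtain ⟨c, hc⟩ := hU.exists_condComplexity_le (hF.comp Computable.fst)
  refine ⟨c, fun x p q h => hc q [] x ?_⟩
  obtain ⟨t, ht⟩ := (hf' _ _).1 h
  refine hF' ((x, p), (q, t)) q x ?_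
  simp [ht]

/-- A reversible machine that erases `x`, given a program of length `m` that computes `C(x)`
from `x`, leaving as garbage a program for `x` and the number `m`. -/
theorem exists_reversible_erasing {U : Word →. Word} (hU : Partrec U) : ∃ R : TM, R.IsReversible ∧
    ∀ (x p s : Word), x ∈ U (pair p []) → natToWord p.length ∈ U (pair s x) →
      R.irrevCost x [] ≤ (p.length + 2 * s.length + 1 : ℕ) := by
  have hpair := primrec_pair.to_comp
  have hlen : Computable (List.length : Word → ℕ) := Primrec.list_length.to_comp
  -- `h₁ (x, n)` selects a program of length `n` for `x`.
  obtain ⟨h₁, hh₁, hs₁, hd₁⟩ := exists_selector (α := Word) (β := Word × ℕ)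
    (G := fun p => (U (pair p [])).map fun x => (x, p.length))
    ((hU.comp (hpair.comp Computable.id (Computable.const []))).map
      (Computable.snd.pair (hlen.comp Computable.fst)).to₂)
  -- `h₂ (x, n, m)` selects, paired with `x`, a program of length `m` that computes `n` from `x`.
  obtain ⟨h₂, hh₂, hs₂, hd₂⟩ := exists_selector (α := Word × Word) (β := Word × ℕ × ℕ)
    (G := fun a => (U (pair a.2 a.1)).map fun z => (a.1, wordToNat z, a.2.length))
    ((hU.comp (hpair.comp Computable.snd Computable.fst)).map
      ((Computable.fst.comp Computable.fst).pair
        ((primrec_wordToNat.to_comp.comp Computable.snd).pair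
          (hlen.comp (Computable.snd.comp Computable.fst)))).to₂)
  let G : Word × ℕ × ℕ →. Word × Word := fun a => (h₁ (a.1, a.2.1)).bind fun p =>
    (h₂ a).map fun b => (pair a.1 b.2, pair [] (List.replicate a.2.2 true ++ false :: p))
  have hG : Partrec G := by
    have k₁ : Computable fun q : ((Word × ℕ × ℕ) × Word) × (Word × Word) =>
        pair q.1.1.1 q.2.2 :=
      hpair.comp (Computable.fst.comp (Computable.fst.comp Computable.fst))
        (Computable.snd.comp Computable.snd)
    have k₂ : Computable fun q : ((Word × ℕ × ℕ) × Word) × (Word × Word) =>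
        List.replicate q.1.1.2.2 true := primrec_replicate_true.to_comp.comp
      (Computable.snd.comp (Computable.snd.comp (Computable.fst.comp Computable.fst)))
    have k₃ : Computable fun q : ((Word × ℕ × ℕ) × Word) × (Word × Word) => false :: q.1.2 :=
      Computable.list_cons.comp (Computable.const false) (Computable.snd.comp Computable.fst)
    have k₄ : Computable₂ fun (q : (Word × ℕ × ℕ) × Word) (b : Word × Word) =>
        (pair q.1.1 b.2, pair [] (List.replicate q.1.2.2 true ++ false :: q.2)) :=
      k₁.pair (hpair.comp (Computable.const []) (Computable.list_append.comp k₂ k₃))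
    have k₅ : Partrec fun q : (Word × ℕ × ℕ) × Word => h₂ q.1 := hh₂.comp Computable.fst
    have k₆ : Partrec fun a : Word × ℕ × ℕ => h₁ (a.1, a.2.1) :=
      hh₁.comp (Computable.fst.pair (Computable.fst.comp Computable.snd))
    exact k₆.bind (k₅.map k₄).to₂
  have hmem : ∀ x n m w v, (w, v) ∈ G (x, n, m) → ∃ p s z, p ∈ h₁ (x, n) ∧ (x, s) ∈ h₂ (x, n, m) ∧
      w = pair x s ∧ v = pair [] (List.replicate m true ++ false :: p) ∧ x ∈ U (pair p []) ∧
      p.length = n ∧ z ∈ U (pair s x) ∧ wordToNat z = n ∧ s.length = m := by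
    intro x n m w v h
    obtain ⟨p, hp, h⟩ := Part.mem_bind_iff.1 h
    obtain ⟨⟨x', s⟩, hs, h⟩ := (Part.mem_map_iff _).1 h
    obtain ⟨x₁, hx₁, e₁⟩ := (Part.mem_map_iff _).1 (hs₁ _ _ hp)
    obtain ⟨z, hz, e₂⟩ := (Part.mem_map_iff _).1 (hs₂ _ _ hs)
    simp only [Prod.mk.injEq] at e₁ e₂ h
    obtain ⟨rfl, e₁⟩ := e₁
    obtain ⟨rfl, e₂, e₃⟩ := e₂
    exact ⟨p, s, z, hp, hs, h.1.symm, h.2.symm, hx₁, e₁, hz, e₂, e₃⟩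
  obtain ⟨R, hR, hR'⟩ := exists_reversible_of_pairs hG
    (by
      -- Forwards: `w` contains `x` and `s`, which give `m = |s|` and `n`, hence `p = h₁ (x, n)`.
      rintro ⟨x, n, m⟩ ⟨x', n', m'⟩ w v v' h h'
      obtain ⟨p, s, z, hp, hs, rfl, rfl, -, -, hz, rfl, rfl⟩ := hmem _ _ _ _ _ h
      obtain ⟨p', s', z', hp', hs', e, rfl, -, -, hz', rfl, rfl⟩ := hmem _ _ _ _ _ h'
      obtain ⟨rfl, rfl⟩ := pair_inj e
      obtain rfl := Part.mem_unique hz hz'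
      rw [Part.mem_unique hp hp'])
    (by
      -- Backwards: `v` contains `m` and `p`, which give `x` and `n = |p|`, hence `s` through `h₂
      -- (x, n, m)`.
      rintro ⟨x, n, m⟩ ⟨x', n', m'⟩ w w' v h h'
      obtain ⟨p, s, z, hp, hs, rfl, rfl, hx, rfl, -, -, -⟩ := hmem _ _ _ _ _ h
      obtain ⟨p', s', z', hp', hs', rfl, e, hx', rfl, -, -, -⟩ := hmem _ _ _ _ _ h'
      obtain ⟨rfl, rfl⟩ := replicate_append_inj (pair_inj e).2
      obtain rfl := Part.mem_unique hx hx'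
      obtain ⟨-, rfl⟩ := Prod.mk.inj (Part.mem_unique hs hs')
      rfl)
  refine ⟨R, hR, fun x p s hx hs => ?_⟩
  have d₁ := hd₁ p (x, p.length) ((Part.mem_map_iff _).2 ⟨x, hx, rfl⟩)
  have d₂ := hd₂ (x, s) (x, p.length, s.length) ((Part.mem_map_iff _).2 ⟨_, hs, by
    simp only [wordToNat_natToWord]⟩)
  obtain ⟨p', hp'⟩ := Part.dom_iff_mem.1 d₁
  obtain ⟨s', hs'⟩ := Part.dom_iff_mem.1 d₂
  have hwv : (pair x s'.2, pair [] (List.replicate s.length true ++ false :: p')) ∈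
      G (x, p.length, s.length) := Part.mem_bind_iff.2 ⟨p', hp', (Part.mem_map_iff _).2 ⟨s', hs', rfl⟩⟩
  -- The selected programs may differ from `p` and `s`, but they have the same lengths, and only
  -- these enter the cost.
  obtain ⟨p₁, s₁, z, -, -, e₁, e₂, -, l₁, -, -, l₂⟩ := hmem x p.length s.length _ _ hwv
  have := hR' _ _ _ hwv
  simp only [e₁, e₂] at this
  refine (TM.irrevCost_le this).trans ?_
  rw [Nat.cast_le, l₂]
  simp only [List.length_append, List.length_replicate, List.length_cons, l₁]
  omega

end RevErasure

/-! ### The cost of erasure -/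

theorem mainTheorem7 (U : RevErasure.Word →. RevErasure.Word) (hU : RevErasure.IsUniversal U)
    (UR : RevErasure.TM) (hUR : UR.IsUniversalReversible) :
    ∃ c : ℕ, ∀ x : RevErasure.Word, ∃ e n m : ℕ,
      UR.irrevCost x [] = (e : ℕ∞) ∧
      RevErasure.complexity U x = (n : ℕ∞) ∧
      RevErasure.condComplexity U (RevErasure.natToWord n) x = (m : ℕ∞) ∧
      n ≤ e + c ∧
      e ≤ n + 2 * m + c ∧
      m ≤ Nat.log 2 (n + 1) + c := by
  obtain ⟨c₁, h₁⟩ := hU.exists_condComplexity_le_length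
  obtain ⟨c₂, h₂⟩ := hU.exists_complexity_le_irrevCost hUR.1
  obtain ⟨R, hR, hR'⟩ := RevErasure.exists_reversible_erasing hU.1
  obtain ⟨c₃, h₃⟩ := hUR.2 R hR
  -- `c₂` serves the lower bound, `c₃ + 1` the upper bound (the `1` is the separator after the unary
  -- `m`), and `c₁` the logarithmic bound.
  refine ⟨c₁ + c₂ + c₃ + 1, fun x => ?_⟩
  obtain ⟨n, hn, -⟩ := ENat.le_natCast_iff.1 (h₁ x [])
  obtain ⟨m, hm, hm'⟩ := ENat.le_natCast_iff.1 (h₁ (RevErasure.natToWord n) x)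
  obtain ⟨p, hp, rfl⟩ := RevErasure.exists_of_condComplexity_eq hn
  obtain ⟨s, hs, rfl⟩ := RevErasure.exists_of_condComplexity_eq hm
  have hle : UR.irrevCost x [] ≤ (p.length + 2 * s.length + 1 + c₃ : ℕ) :=
    (h₃ x []).trans (by push_cast; gcongr; exact_mod_cast hR' x p s hp hs)
  obtain ⟨e, he, he'⟩ := ENat.le_natCast_iff.1 hle
  obtain ⟨p', q, hpq, hlen⟩ := RevErasure.TM.exists_of_irrevCost_eq he
  have hq := h₂ x p' q hpq
  rw [show RevErasure.complexity U x = (p.length : ℕ∞) from hn, Nat.cast_le] at hq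
  have hlog := RevErasure.length_natToWord_le p.length
  exact ⟨e, p.length, s.length, he, hn, hm, by omega, by omega, by omega⟩
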